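/- All graphs are finite, simple and undirected. For $k\ge 1$, a graph $G$ is $k$-connected if it has more than $k$ vertices and $G-S$ is connected for every set $S$ of fewer than $k$ vertices. A matching $M$ in a $k$-connected graph $G$ is $k$-removable if the graph $G-M$, obtained by deleting the edges of $M$ (and no vertices), is still $k$-connected. For integers $\delta>k\ge 1$, let $f(k,\delta)$ be the largest integer $\ell$ such that every $k$-connected graph with at least $2\delta$ vertices and minimum degree at least $\delta$ has a $k$-removable matching of size $\ell$. Theorem. Let $\delta$ and $k$ be integers with $\delta>k\ge 1$. The maximum defining $f(k,\delta)$ exists, and the following hold. (i) If $\delta\ge 3k-1$, then $f(k,\delta)\le\delta$ and, unless $(k,\delta)=(1,2)$, also $f(k,\delta)\ge(\delta+1)/2$. (ii) $f(1,2)=1$, and $f(1,\delta)=\delta$ for every $\delta\ge 3$. (iii) $2\lfloor(\delta-2)/2\rfloor\le f(2,\delta)\le\delta$ for every $\delta\ge 3$. (iv) $2\le f(k,k+1)\le k$ for every $k\ge 2$; in particular, $f(2,3)=2$. -/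

import Mathlib

namespace RemovableMatching

/-- `G` is `k`-connected: it has more than `k` vertices, and deleting fewer than `k` vertices
always leaves a connected graph. -/
def IsKConnected {V : Type*} (G : SimpleGraph V) (k : ℕ) : Prop :=
  k < Nat.card V ∧ ∀ S : Finset V, S.card < k → (G.induce ((S : Set V)ᶜ)).Connected

/-- The matching `M` of `G` is `k`-removable: deleting its edges (and no vertices) from `G`
leaves a `k`-connected graph. -/
def IsKRemovable {V : Type*} {G : SimpleGraph V} (M : G.Subgraph) (k : ℕ) : Prop :=
  M.IsMatching ∧ IsKConnected (G.deleteEdges M.edgeSet) k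

/-- Every finite `k`-connected graph with at least `2 * δ` vertices and minimum degree at least `δ`
has a `k`-removable matching with exactly `ℓ` edges. -/
def Guaranteed (k δ ℓ : ℕ) : Prop :=
  ∀ (V : Type) [Fintype V] (G : SimpleGraph V) [DecidableRel G.Adj],
    IsKConnected G k → 2 * δ ≤ Fintype.card V → δ ≤ G.minDegree →
      ∃ M : G.Subgraph, IsKRemovable M k ∧ M.edgeSet.ncard = ℓ

/-- `f k δ` is the largest `ℓ` such that every `k`-connected graph with at least `2 * δ` vertices
and minimum degree at least `δ` has a `k`-removable matching of size `ℓ`. -/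
noncomputable def f (k δ : ℕ) : ℕ := sSup {ℓ : ℕ | Guaranteed k δ ℓ}

end RemovableMatching

/-!
Everything is expressed through separations. A matching is handled as a spanning subgraph `N` of
maximum degree one, and it is `k`-removable when `H = G - N` has no separation `(Y, Z)` with fewer
than `k` vertices in `Z` (`IsSep`, `KConn`, `Removable`).

The tool for `k ≥ 2` is Mader's theorem, `exists_essential_degree_le_one`: in a `k`-connected graph
the edges whose deletion destroys `k`-connectivity form a forest on the vertices of degree more than
`k`. Applied to `G - N` for a maximum removable matching `N`, it shows that the uncovered vertices
induce a forest in `G` (`Removable.isForestOn`). A leaf of this forest has at least `δ - 1` covered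
neighbours, which gives a matching of size about `δ / 2`. The last step to `(δ + 1) / 2`
for `δ ≥ 3k - 1`, and to `2` for `δ = k + 1`, comes from two leaves `u`, `w` of the forest that are
joined to the two ends of an edge `xy` of `N`: the augmented matching `N - xy + xu + yw` is not
removable, and a separation showing this contradicts the degrees of further leaves
(`false_of_isSep_of_leaf`, `false_of_isSep_of_card_cov_eq_two`).

For `k = 1` and `k = 2` larger matchings are obtained differently. Among all matchings of the
desired size, `δ` or `δ - 2`, let `N` leave the fewest separations in `H = G - N`
(`IsSepMinimal`). If there is one, choose a side `K` with at most half of the covered vertices. An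
edge of `N` crosses the separation, and it could be exchanged for any nonessential edge of `H` in
`K` that meets no other edge of `N`. So all such edges are essential in `H`
(`IsSepMinimal.exists_isSep`). For `k = 2` let `K` be the interior of an end-block of `H`; then
Mader's theorem in this block and the degrees are contradictory (`IsSepMinimal.le_card_inter_cov`).
For `k = 1` essential edges are bridges, and one looks at minimal sets left by at most one edge of
`H`; the only remaining case is a perfect matching between two cliques of size `δ`, in which two
edges of `N` can be exchanged at once (`exists_removable_of_connected`).

The upper bounds are attained by the complete graph on `2δ` vertices, which has no larger matching,
and, for `δ = k + 1`, by a cycle of length `k + 3` all of whose vertices are joined to `k - 1` hubs: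
removing two edges of the cycle would let the hubs separate it (`hubCycle_card_cov_le`).
-/

namespace RemovableMatching

open Finset
open scoped Classical

variable {V : Type*}

/-! ### Separations -/

/-- `(Y, Z)` is a separation of order less than `k` of the induced subgraph `H[X]`: in `H[X]`, the
nonempty set `Y` has all its outside neighbours in `Z`, and something is left of `X` outside
`Y ∪ Z`. The separator `Z` need not be contained in `X`. -/
structure IsSep (H : SimpleGraph V) (X : Finset V) (k : ℕ) (Y Z : Finset V) : Prop where
  subset : Y ⊆ X
  nonempty : Y.Nonempty
  disjoint : Disjoint Y Z
  card_lt : #Z < k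
  closed : ∀ y ∈ Y, ∀ x ∈ X, H.Adj y x → x ∈ Y ∨ x ∈ Z
  exists_not_mem : ∃ x ∈ X, x ∉ Y ∧ x ∉ Z

/-- `H[X]` has no separation of order less than `k`. This is `k`-connectivity without the
requirement on the number of vertices. -/
def KConn (H : SimpleGraph V) (X : Finset V) (k : ℕ) : Prop :=
  ∀ Y Z, ¬ IsSep H X k Y Z

lemma IsSep.compl {H : SimpleGraph V} {X : Finset V} {k : ℕ} {Y Z : Finset V}
    (h : IsSep H X k Y Z) : IsSep H X k (X \ (Y ∪ Z)) Z := by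
  obtain ⟨x, hx, hxY, hxZ⟩ := h.exists_not_mem
  obtain ⟨y, hy⟩ := h.nonempty
  refine ⟨sdiff_subset, ⟨x, by grind⟩, ?_, h.card_lt, ?_, ⟨y, h.subset hy, by grind, ?_⟩⟩
  · rw [disjoint_left]; grind
  · intro a ha b hb hab
    by_contra hcon
    have := h.closed b (by grind) a (by grind) hab.symm
    grind
  · exact disjoint_left.1 h.disjoint hy

lemma IsSep.anti {H H' : SimpleGraph V} (hle : H' ≤ H) {X : Finset V} {k : ℕ} {Y Z : Finset V}
    (h : IsSep H X k Y Z) : IsSep H' X k Y Z :=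
  ⟨h.subset, h.nonempty, h.disjoint, h.card_lt, fun y hy x hx hyx => h.closed y hy x hx (hle hyx),
    h.exists_not_mem⟩

lemma KConn.mono {H H' : SimpleGraph V} (hle : H' ≤ H) {X : Finset V} {k : ℕ}
    (h : KConn H' X k) : KConn H X k :=
  fun Y Z hs => h Y Z (hs.anti hle)

lemma isKConnected_iff [Fintype V] {H : SimpleGraph V} {k : ℕ} :
    IsKConnected H k ↔ k < Fintype.card V ∧ KConn H univ k := by
  unfold IsKConnected
  rw [Nat.card_eq_fintype_card]
  refine and_congr_right fun hk => ⟨fun h Y Z hs => ?_, fun h S hS => ?_⟩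
  · obtain ⟨x, -, hxY, hxZ⟩ := hs.exists_not_mem
    obtain ⟨y, hy⟩ := hs.nonempty
    have hyZ : y ∉ Z := disjoint_left.1 hs.disjoint hy
    have hr := (h Z hs.card_lt).preconnected ⟨y, by simpa using hyZ⟩ ⟨x, by simpa using hxZ⟩
    obtain ⟨p⟩ := hr
    have key : ∀ (a b : ((Z : Set V)ᶜ : Set V)), (H.induce ((Z : Set V)ᶜ)).Walk a b →
        (a : V) ∈ Y → (b : V) ∈ Y := by
      intro a b p
      induction p with
      | nil => exact id
      | @cons a c b hac p ih =>
        intro ha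
        refine ih ?_
        have := hs.closed a ha c (mem_univ _) hac
        have hc : (c : V) ∉ Z := fun h => c.2 (mem_coe.2 h)
        tauto
    exact hxY (key _ _ p hy)
  · have hne : ∃ x, x ∉ S := by
      by_contra! hcon
      have : S = univ := by ext x; simp [hcon x]
      rw [this, card_univ] at hS
      omega
    obtain ⟨x0, hx0⟩ := hne
    have : Nonempty ((S : Set V)ᶜ : Set V) := ⟨⟨x0, by simpa using hx0⟩⟩
    refine ⟨fun a b => ?_⟩
    by_contra hab
    refine h {x | ∃ hx : x ∉ S, (H.induce ((S : Set V)ᶜ)).Reachable a ⟨x, by simpa using hx⟩} S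
      ⟨subset_univ _, ⟨a, ?_⟩, ?_, hS, ?_, ⟨b, mem_univ _, ?_, fun h => b.2 (mem_coe.2 h)⟩⟩
    · simp only [mem_filter, mem_univ, true_and]
      exact ⟨fun h => a.2 (mem_coe.2 h), SimpleGraph.Reachable.refl _⟩
    · rw [disjoint_left]; simp only [mem_filter, mem_univ, true_and]; rintro x ⟨hx, -⟩; exact hx
    · intro y hy x _ hyx
      simp only [mem_filter, mem_univ, true_and] at hy ⊢
      obtain ⟨hyS, hr⟩ := hy
      by_cases hxS : x ∈ S
      · exact Or.inr hxS
      · refine Or.inl ⟨hxS, hr.trans (SimpleGraph.Adj.reachable ?_)⟩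
        simpa using hyx
    · simp only [mem_filter, mem_univ, true_and]
      rintro ⟨_, hr⟩
      exact hab hr

/-! ### Essential edges -/

lemma deleteEdges_pair_adj {G : SimpleGraph V} {a b x y : V} :
    (G.deleteEdges {s(a, b)}).Adj x y ↔
      G.Adj x y ∧ ¬ (x = a ∧ y = b ∨ x = b ∧ y = a) := by
  simp [SimpleGraph.deleteEdges_adj]

/-- The edge `ab` of `G[X]` is essential: deleting it destroys `k`-connectivity. -/
def Essential (G : SimpleGraph V) (X : Finset V) (k : ℕ) (a b : V) : Prop :=
  G.Adj a b ∧ ¬ KConn (G.deleteEdges {s(a, b)}) X k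

/-- A fragment `A` of the edge `va`, with separator `S`: in `G[X]` the edge `va` is the only one
from `A ∋ a` to the rest of `X` outside `S`, and `v` belongs to that rest. -/
structure IsFragment (G : SimpleGraph V) (X : Finset V) (k : ℕ) (v a : V) (A S : Finset V) :
    Prop where
  adj : G.Adj v a
  mem_X : v ∈ X
  mem : a ∈ A
  subset : A ⊆ X
  disjoint : ∀ x ∈ A, x ∉ S
  card_lt : #S < k
  closed : ∀ y ∈ A, ∀ x ∈ X, G.Adj y x → x ∈ A ∨ x ∈ S ∨ (y = a ∧ x = v)
  not_mem : v ∉ A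
  not_mem_sep : v ∉ S

lemma IsFragment.compl {G : SimpleGraph V} {X : Finset V} {k : ℕ} {v a : V} {A S : Finset V}
    (h : IsFragment G X k v a A S) : IsFragment G X k a v (X \ (A ∪ S)) S where
  adj := h.adj.symm
  mem_X := h.subset h.mem
  mem := by have := h.mem_X; have := h.not_mem; have := h.not_mem_sep; grind
  subset := sdiff_subset
  disjoint := by grind
  card_lt := h.card_lt
  closed := by
    intro y hy x hx hyx
    by_cases hxA : x ∈ A
    · have := h.closed x hxA y (by grind) hyx.symm
      grind
    · grind
  not_mem := by have := h.mem; grind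
  not_mem_sep := h.disjoint a h.mem

/-- In a `k`-connected graph, every separation left by the deletion of an edge has the two ends
of that edge on different sides. -/
lemma IsSep.isFragment {G : SimpleGraph V} {X : Finset V} {k : ℕ} {a v : V} {Y Z : Finset V}
    (hG : KConn G X k) (h : IsSep (G.deleteEdges {s(v, a)}) X k Y Z) :
    IsFragment G X k v a Y Z ∨ IsFragment G X k a v Y Z := by
  have hcl : ¬ ∀ y ∈ Y, ∀ x ∈ X, G.Adj y x → x ∈ Y ∨ x ∈ Z := fun hcl =>
    hG Y Z ⟨h.subset, h.nonempty, h.disjoint, h.card_lt, hcl, h.exists_not_mem⟩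
  push Not at hcl
  obtain ⟨y, hy, x, hx, hyx, hxY, hxZ⟩ := hcl
  have hd := disjoint_left.1 h.disjoint
  have hc := h.closed
  simp only [deleteEdges_pair_adj] at hc
  have hyx' := hc y hy x hx
  have : (y = v ∧ x = a) ∨ (y = a ∧ x = v) := by tauto
  rcases this with ⟨rfl, rfl⟩ | ⟨rfl, rfl⟩
  · right
    refine ⟨hyx.symm, hx, hy, h.subset, hd, h.card_lt, ?_, hxY, hxZ⟩
    intro p hp q hq hpq
    have := hc p hp q hq
    grind
  · left
    refine ⟨hyx.symm, hx, hy, h.subset, hd, h.card_lt, ?_, hxY, hxZ⟩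
    intro p hp q hq hpq
    have := hc p hp q hq
    grind

lemma Essential.exists_isFragment {G : SimpleGraph V} {X : Finset V} {k : ℕ} {v a : V}
    (hG : KConn G X k) (h : Essential G X k v a) : ∃ A S, IsFragment G X k v a A S := by
  obtain ⟨-, hn⟩ := h
  unfold KConn at hn
  push Not at hn
  obtain ⟨Y, Z, hs⟩ := hn
  rcases hs.isFragment hG with h1 | h1
  · exact ⟨_, _, h1⟩
  · exact ⟨_, _, h1.compl⟩

lemma Essential.symm {G : SimpleGraph V} {X : Finset V} {k : ℕ} {a b : V}
    (h : Essential G X k a b) : Essential G X k b a :=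
  ⟨h.1.symm, by rw [Sym2.eq_swap]; exact h.2⟩

/-- If two essential edges `va`, `vb` meet in a vertex `v` of degree more than `k`, then fragments
of `va` and `vb` that avoid `v` are disjoint. -/
lemma IsFragment.disjoint_of_degree {G : SimpleGraph V} {X : Finset V} {k : ℕ} {v a b : V}
    {A S B T : Finset V} (hG : KConn G X k) (hdeg : k < #{x ∈ X | G.Adj v x}) (hab : a ≠ b)
    (hA : IsFragment G X k v a A S) (hB : IsFragment G X k v b B T) : ∀ p ∈ A, p ∉ B := by
  intro p hpA hpB
  have hAd := hA.disjoint
  have hBd := hB.disjoint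
  have hAc := hA.closed
  have hBc := hB.closed
  have hvX := hA.mem_X
  have hvA := hA.not_mem
  have hvB := hB.not_mem
  have hvS := hA.not_mem_sep
  have hvT := hB.not_mem_sep
  have haB : a ∉ B := fun haB => by
    have := hBc a haB v hvX hA.adj.symm
    grind
  have hbA : b ∉ A := fun hbA => by
    have := hAc b hbA v hvX hB.adj.symm
    grind
  -- the boundaries of the two opposite corners `A ∩ B` and `V \ (A ∪ S ∪ B ∪ T)`
  set C₁ := T ∩ A ∪ S ∩ T ∪ S ∩ B with hC₁
  set C₂ := T \ A ∪ S \ B with hC₂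
  have hcard : #C₁ + #C₂ ≤ #S + #T := by
    rw [← card_union_add_card_inter, ← card_union_add_card_inter S T]
    refine add_le_add (card_le_card ?_) (card_le_card ?_)
    · grind
    · grind
  have h₁ : k ≤ #C₁ := by
    by_contra! hlt
    refine hG (A ∩ B) C₁ ⟨?_, ⟨p, by grind⟩, ?_, hlt, ?_, ⟨v, hvX, by grind, by grind⟩⟩
    · exact inter_subset_left.trans hA.subset
    · rw [disjoint_left]; grind
    · intro y hy x hx hyx
      have h1 := hAc y (by grind) x hx hyx
      have h2 := hBc y (by grind) x hx hyx
      grind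
  have hS := hA.card_lt
  have hT := hB.card_lt
  have hY : ∀ y ∈ X, y ∉ A → y ∉ S → y ∉ B → y ∉ T → y = v := by
    by_contra! hcon
    obtain ⟨y, hyX, hyA, hyS, hyB, hyT, hyv⟩ := hcon
    refine hG (X \ (A ∪ S ∪ B ∪ T ∪ {v})) (insert v C₂) ⟨sdiff_subset, ⟨y, by grind⟩, ?_, ?_, ?_,
      ⟨p, hA.subset hpA, by grind, ?_⟩⟩
    · rw [disjoint_left]; grind
    · have := card_insert_le v C₂
      omega
    · intro y hy x hx hyx
      have h1 := hAc x
      have h2 := hBc x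
      have h3 := hyx.symm
      grind
    · grind
  have hsub : ({x ∈ X | G.Adj v x} : Finset V) ⊆ insert a (insert b C₂) := by
    intro x hx
    have h1 := hAc x
    have h2 := hBc x
    have h3 : G.Adj x v := by have := (mem_filter.1 hx).2; exact this.symm
    have h4 := h3.ne
    have h5 := hY x
    grind
  have := card_le_card hsub
  have := card_insert_le a (insert b C₂)
  have := card_insert_le b C₂
  omega

/-- **Mader's theorem**: in a `k`-connected graph, the essential edges among vertices of degree
more than `k` form a forest. The forest property is stated as the existence, in each nonempty
vertex set, of a vertex with at most one essential edge to that set. -/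
theorem exists_essential_degree_le_one {G : SimpleGraph V} {X : Finset V} {k : ℕ}
    (hG : KConn G X k) {W : Finset V} (hW : W.Nonempty)
    (hdeg : ∀ a ∈ W, k < #{x ∈ X | G.Adj a x}) :
    ∃ a ∈ W, ∀ b ∈ W, ∀ c ∈ W, Essential G X k a b → Essential G X k a c → b = c := by
  by_contra! hcon
  -- a fragment of least size yields a contradiction
  have key : ∀ n, ∀ v a A S, a ∈ W → IsFragment G X k v a A S → #A = n → False := by
    intro n
    induction n using Nat.strong_induction_on with
    | _ n ih =>
    intro v a A S haW hA hn
    obtain ⟨c, hcW, hcv, hess⟩ : ∃ c ∈ W, c ≠ v ∧ Essential G X k a c := by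
      obtain ⟨b, hb, c, hc, h1, h2, h3⟩ := hcon a haW
      by_cases hbv : b = v
      · exact ⟨c, hc, by grind, h2⟩
      · exact ⟨b, hb, hbv, h1⟩
    obtain ⟨C, T, hC⟩ := hess.exists_isFragment hG
    have hle : #A ≤ #C := by
      by_contra! hlt
      exact ih _ (hn ▸ hlt) a c C T hcW hC rfl
    have hdis := hA.compl.disjoint_of_degree hG (hdeg a haW) hcv.symm hC
    have hAd := hA.disjoint
    have hCd := hC.disjoint
    have hAc := hA.closed
    have hCc := hC.closed
    have haA := hA.mem
    have haC := hC.not_mem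
    have haT := hC.not_mem_sep
    have hvX := hA.mem_X
    have hvA := hA.not_mem
    have hvS := hA.not_mem_sep
    have hCX := hC.subset
    have hS := hA.card_lt
    set D := T ∩ A ∪ S \ C with hD
    have h1 : #C ≤ #(C ∩ A) + #(C ∩ S) := by
      refine (card_le_card (t := C ∩ A ∪ C ∩ S) ?_).trans (card_union_le _ _)
      intro x hx
      have := hdis x
      have := hCX hx
      grind
    have h2 : #(C ∩ A) + #(T ∩ A) + 1 ≤ #A := by
      have e1 : #(C ∩ A ∪ T ∩ A) = #(C ∩ A) + #(T ∩ A) :=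
        card_union_of_disjoint (by rw [disjoint_left]; grind)
      have e2 : #(insert a (C ∩ A ∪ T ∩ A)) = #(C ∩ A ∪ T ∩ A) + 1 :=
        card_insert_of_notMem (by grind)
      have e3 : #(insert a (C ∩ A ∪ T ∩ A)) ≤ #A := card_le_card (by grind)
      omega
    have h3 : #D ≤ #(T ∩ A) + #(S \ C) := card_union_le _ _
    have h4 : #(S \ C) + #(C ∩ S) = #S := by
      rw [inter_comm C S]; exact card_sdiff_add_card_inter S C
    have hY : ∀ y ∈ A, y ∉ C → y ∉ T → y = a := by
      by_contra! hcon
      obtain ⟨y, hyA, hyC, hyT, hya⟩ := hcon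
      refine hG (A \ (C ∪ T ∪ {a})) (insert a D) ⟨sdiff_subset.trans hA.subset, ⟨y, by grind⟩, ?_,
        ?_, ?_, ⟨v, hvX, by grind, ?_⟩⟩
      · rw [disjoint_left]; grind
      · have := card_insert_le a D
        omega
      · intro y hy x hx hyx
        have := hAc y (by grind) x hx hyx
        have := hCc x
        have := hA.subset (show y ∈ A by grind)
        have := hyx.symm
        grind
      · grind
    have hsub : ({x ∈ X | G.Adj a x} : Finset V) ⊆ insert v (insert c D) := by
      intro x hx
      obtain ⟨hxX, hax⟩ := mem_filter.1 hx
      have := hAc a haA x hxX hax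
      have := hCc x
      have := hY x
      have := hax.symm
      have := hax.ne
      have := hA.subset haA
      grind
    have := card_le_card hsub
    have := card_insert_le v (insert c D)
    have := card_insert_le c D
    have := hdeg a haW
    omega
  obtain ⟨a, ha⟩ := hW
  obtain ⟨b, hb, -, -, hess, -, -⟩ := hcon a ha
  obtain ⟨A, S, hA⟩ := hess.exists_isFragment hG
  exact key _ a b A S hb hA rfl

/-- `G[U]` is a forest, expressed as `1`-degeneracy: every nonempty `P ⊆ U` has a vertex with at
most one neighbour in `P`. -/
def IsForestOn (G : SimpleGraph V) (U : Finset V) : Prop :=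
  ∀ P ⊆ U, P.Nonempty → ∃ a ∈ P, ∀ b ∈ P, ∀ c ∈ P, G.Adj a b → G.Adj a c → b = c

/-- A forest with at least two vertices has at least two vertices of degree at most one. -/
lemma IsForestOn.exists_two_leaves {G : SimpleGraph V} {U : Finset V} (hU : IsForestOn G U)
    {P : Finset V} (hP : P ⊆ U) (hcard : 2 ≤ #P) :
    ∃ u ∈ P, ∃ w ∈ P, u ≠ w ∧ (∀ b ∈ P, ∀ c ∈ P, G.Adj u b → G.Adj u c → b = c) ∧
      ∀ b ∈ P, ∀ c ∈ P, G.Adj w b → G.Adj w c → b = c := by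
  induction hn : #P generalizing P with
  | zero => omega
  | succ n ih =>
    obtain ⟨v, hv, hlow⟩ := hU P hP (card_pos.1 (by omega))
    have hc : #(P.erase v) = n := by rw [card_erase_of_mem hv, hn]; rfl
    rcases Nat.lt_or_ge n 2 with h2 | h2
    · obtain ⟨w, hw⟩ := card_eq_one.1 (show #(P.erase v) = 1 by omega)
      have hPw : ∀ x ∈ P, x = v ∨ x = w := by
        intro x hx
        by_cases hxv : x = v
        · exact Or.inl hxv
        · right
          have : x ∈ P.erase v := mem_erase.2 ⟨hxv, hx⟩
          rw [hw] at this
          simpa using this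
      have hwm : w ∈ P.erase v := by rw [hw]; simp
      have hirr : ¬ G.Adj w w := SimpleGraph.irrefl G
      refine ⟨v, hv, w, (mem_erase.1 hwm).2, (mem_erase.1 hwm).1.symm, hlow, ?_⟩
      grind
    · obtain ⟨u, hu, w, hw, huw, hlu, hlw⟩ := ih (P := P.erase v) (by grind) (by omega) hc
      by_cases hvu : G.Adj v u
      · have hvw : ¬ G.Adj v w := fun h => huw (hlow u (by grind) w (by grind) hvu h)
        have := G.adj_comm w v
        refine ⟨v, hv, w, by grind, by grind, hlow, ?_⟩
        intro b hb c hc hb' hc'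
        exact hlw b (by grind) c (by grind) hb' hc'
      · have := G.adj_comm u v
        refine ⟨v, hv, u, by grind, by grind, hlow, ?_⟩
        intro b hb c hc hb' hc'
        exact hlu b (by grind) c (by grind) hb' hc'

/-! ### Matchings as graphs of maximum degree one -/

/-- `N` is a matching of `G`, given as a spanning subgraph of maximum degree at most one. -/
structure IsMatch (G N : SimpleGraph V) : Prop where
  le : N ≤ G
  unique : ∀ a b c, N.Adj a b → N.Adj a c → b = c

/-- The set of vertices covered by the matching `N`. -/
noncomputable def cov [Fintype V] (N : SimpleGraph V) : Finset V := {a | ∃ b, N.Adj a b}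

lemma mem_cov [Fintype V] {N : SimpleGraph V} {a : V} : a ∈ cov N ↔ ∃ b, N.Adj a b := by
  simp [cov]

lemma left_mem_cov [Fintype V] {N : SimpleGraph V} {a b : V} (h : N.Adj a b) : a ∈ cov N :=
  mem_cov.2 ⟨b, h⟩

lemma right_mem_cov [Fintype V] {N : SimpleGraph V} {a b : V} (h : N.Adj a b) : b ∈ cov N :=
  mem_cov.2 ⟨a, h.symm⟩

lemma sup_edge_adj {N : SimpleGraph V} {a b x y : V} (hab : a ≠ b) :
    (N ⊔ SimpleGraph.edge a b).Adj x y ↔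
      N.Adj x y ∨ (x = a ∧ y = b ∨ x = b ∧ y = a) := by
  rw [SimpleGraph.sup_adj, SimpleGraph.edge_adj]
  grind

lemma IsMatch.bot (G : SimpleGraph V) : IsMatch G ⊥ := ⟨bot_le, by simp⟩

lemma IsMatch.deleteEdges {G N : SimpleGraph V} (hN : IsMatch G N) (s : Set (Sym2 V)) :
    IsMatch G (N.deleteEdges s) :=
  ⟨(SimpleGraph.deleteEdges_le s).trans hN.le, fun a b c h1 h2 =>
    hN.unique a b c (SimpleGraph.deleteEdges_le s h1) (SimpleGraph.deleteEdges_le s h2)⟩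

section Fintype

variable [Fintype V]

lemma IsMatch.sup_edge {G N : SimpleGraph V} (hN : IsMatch G N) {a b : V} (hab : G.Adj a b)
    (ha : a ∉ cov N) (hb : b ∉ cov N) : IsMatch G (N ⊔ SimpleGraph.edge a b) := by
  have hne := hab.ne
  have h1 := hN.unique
  have h2 := hab.symm
  rw [mem_cov] at ha hb
  push Not at ha hb
  have hs := N.symm
  refine ⟨fun x y hxy => ?_, fun x y z hxy hxz => ?_⟩
  · rw [sup_edge_adj hne] at hxy
    rcases hxy with h | ⟨rfl, rfl⟩ | ⟨rfl, rfl⟩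
    · exact hN.le h
    · exact hab
    · exact h2
  · rw [sup_edge_adj hne] at hxy hxz
    grind

lemma exists_partner (N : SimpleGraph V) : ∃ σ : V → V, ∀ x ∈ cov N, N.Adj x (σ x) := by
  have h : ∀ x, ∃ y, x ∈ cov N → N.Adj x y := fun x => by
    by_cases hx : x ∈ cov N
    · obtain ⟨y, hy⟩ := mem_cov.1 hx
      exact ⟨y, fun _ => hy⟩
    · exact ⟨x, fun h => absurd h hx⟩
  choose σ hσ using h
  exact ⟨σ, hσ⟩

lemma card_cov_sup_edge {N : SimpleGraph V} {a b : V} (hab : a ≠ b)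
    (ha : a ∉ cov N) (hb : b ∉ cov N) : #(cov (N ⊔ SimpleGraph.edge a b)) = #(cov N) + 2 := by
  have : cov (N ⊔ SimpleGraph.edge a b) = insert a (insert b (cov N)) := by
    ext x
    simp only [mem_cov, sup_edge_adj hab, mem_insert]
    grind
  rw [this, card_insert_of_notMem (by grind), card_insert_of_notMem hb]

lemma IsMatch.cov_deleteEdges {G N : SimpleGraph V} (hN : IsMatch G N) {x y : V}
    (hxy : N.Adj x y) : cov (N.deleteEdges {s(x, y)}) = (cov N) \ {x, y} := by
  have h1 := hN.unique
  have h2 := hxy.symm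
  ext z
  simp only [mem_cov, deleteEdges_pair_adj, mem_sdiff, mem_insert, mem_singleton]
  grind

lemma IsMatch.card_cov_deleteEdges {G N : SimpleGraph V} (hN : IsMatch G N) {x y : V}
    (hxy : N.Adj x y) : #(cov (N.deleteEdges {s(x, y)})) + 2 = #(cov N) := by
  have hsub : ({x, y} : Finset V) ⊆ cov N := by
    have := left_mem_cov hxy
    have := right_mem_cov hxy
    grind
  have := card_sdiff_add_card_eq_card hsub
  rw [hN.cov_deleteEdges hxy, ← this, card_pair hxy.ne]

lemma IsMatch.card_cov {G N : SimpleGraph V} (hN : IsMatch G N) :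
    #(cov N) = 2 * N.edgeSet.ncard := by
  have h := N.sum_degrees_eq_twice_card_edges
  have h2 : ∀ v, N.degree v = if v ∈ cov N then 1 else 0 := by
    intro v
    split_ifs with hv
    · obtain ⟨b, hb⟩ := mem_cov.1 hv
      rw [← SimpleGraph.card_neighborFinset_eq_degree, card_eq_one]
      refine ⟨b, ?_⟩
      ext c
      simp only [SimpleGraph.mem_neighborFinset, mem_singleton]
      exact ⟨fun hc => hN.unique v c b hc hb, fun hc => hc ▸ hb⟩
    · rw [← SimpleGraph.card_neighborFinset_eq_degree, card_eq_zero]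
      ext c
      simp only [SimpleGraph.mem_neighborFinset, notMem_empty, iff_false]
      exact fun hc => hv (left_mem_cov hc)
  rw [sum_congr rfl (fun v _ => h2 v)] at h
  rw [sum_ite_mem, univ_inter, sum_const, smul_eq_mul, mul_one] at h
  rw [h, Set.ncard_eq_toFinset_card']
  rfl

/-- A matching contains matchings of all smaller sizes. -/
lemma IsMatch.exists_card_cov_eq {G N : SimpleGraph V} (hN : IsMatch G N) {ℓ : ℕ}
    (hℓ : 2 * ℓ ≤ #(cov N)) : ∃ N', N' ≤ N ∧ IsMatch G N' ∧ #(cov N') = 2 * ℓ := by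
  induction hn : #(cov N) using Nat.strong_induction_on generalizing N with
  | _ n ih =>
    by_cases he : #(cov N) = 2 * ℓ
    · exact ⟨N, le_rfl, hN, he⟩
    · obtain ⟨x, hx⟩ := card_pos.1 (show 0 < #(cov N) by omega)
      obtain ⟨y, hxy⟩ := mem_cov.1 hx
      have h1 := hN.card_cov
      have h2 := hN.card_cov_deleteEdges hxy
      obtain ⟨N', hle, h3⟩ := ih _ (by omega) (hN.deleteEdges {s(x, y)}) (by omega) rfl
      exact ⟨N', hle.trans (SimpleGraph.deleteEdges_le _), h3⟩

/-- Exchange along a path: `u x y w` with `xy ∈ N` and `u`, `w` not covered gives a larger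
matching. -/
lemma IsMatch.exchange {G N : SimpleGraph V} (hN : IsMatch G N) {x y u w : V} (hxy : N.Adj x y)
    (hu : u ∉ cov N) (hw : w ∉ cov N) (huw : u ≠ w) (hxu : G.Adj x u) (hyw : G.Adj y w) :
    ∃ N', IsMatch G N' ∧ #(cov N') = #(cov N) + 2 ∧ ∀ a b, N'.Adj a b ↔
      (N.Adj a b ∧ ¬ (a = x ∧ b = y ∨ a = y ∧ b = x)) ∨ (a = x ∧ b = u ∨ a = u ∧ b = x) ∨
        (a = y ∧ b = w ∨ a = w ∧ b = y) := by
  have hx := left_mem_cov hxy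
  have hy := right_mem_cov hxy
  have hne := hxy.ne
  have hN1 := hN.deleteEdges {s(x, y)}
  have c1 := hN.cov_deleteEdges hxy
  have d1 := hN.card_cov_deleteEdges hxy
  have hx1 : x ∉ cov (N.deleteEdges {s(x, y)}) := by rw [c1]; simp
  have hu1 : u ∉ cov (N.deleteEdges {s(x, y)}) := by rw [c1]; simp [hu]
  have hN2 := hN1.sup_edge hxu hx1 hu1
  have d2 := card_cov_sup_edge hxu.ne hx1 hu1
  have c2 : ∀ z, z ∈ cov (N.deleteEdges {s(x, y)} ⊔ SimpleGraph.edge x u) →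
      z ∈ (cov N) \ {x, y} ∨ z = x ∨ z = u := by
    intro z hz
    rw [← c1]
    simp only [mem_cov, sup_edge_adj hxu.ne] at hz ⊢
    grind
  have hy2 : y ∉ cov (N.deleteEdges {s(x, y)} ⊔ SimpleGraph.edge x u) := fun h => by
    have := c2 y h
    grind
  have hw2 : w ∉ cov (N.deleteEdges {s(x, y)} ⊔ SimpleGraph.edge x u) := fun h => by
    have := c2 w h
    grind
  refine ⟨_, hN2.sup_edge hyw hy2 hw2, ?_, fun a b => ?_⟩
  · rw [card_cov_sup_edge hyw.ne hy2 hw2]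
    omega
  · rw [sup_edge_adj hyw.ne, sup_edge_adj hxu.ne, deleteEdges_pair_adj, or_assoc]

/-- Exchange along a `4`-cycle: two edges `uv`, `u'v'` of a matching are replaced by `uu'`,
`vv'`. -/
lemma IsMatch.exchange_two {G N : SimpleGraph V} (hM : IsMatch G N) {u v u' v' : V}
    (huv : N.Adj u v) (huv' : N.Adj u' v') (huu' : G.Adj u u') (hvv' : G.Adj v v') :
    ∃ N', IsMatch G N' ∧ #(cov N') = #(cov N) ∧ ∀ x y, N'.Adj x y ↔
      (((N.Adj x y ∧ ¬ (x = u ∧ y = v ∨ x = v ∧ y = u)) ∧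
        ¬ (x = u' ∧ y = v' ∨ x = v' ∧ y = u')) ∨ (x = u ∧ y = u' ∨ x = u' ∧ y = u)) ∨
        (x = v ∧ y = v' ∨ x = v' ∧ y = v) := by
  have n1 := huu'.ne
  have n2 := hvv'.ne
  have n3 := huv.ne
  have n4 := huv'.ne
  by_cases huv'' : u = v'
  · -- then `v = u'`, and the two edges coincide
    subst huv''
    obtain rfl := hM.unique _ _ _ huv huv'.symm
    exact ⟨N, hM, rfl, by have := N.symm; grind⟩
  have n5 : v ≠ u' := fun h => by
    subst h
    exact huv'' (hM.unique _ _ _ huv.symm huv')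
  have hN1 := hM.deleteEdges {s(u, v)}
  have c1 := hM.cov_deleteEdges huv
  have d1 := hM.card_cov_deleteEdges huv
  have huv1 : (N.deleteEdges {s(u, v)}).Adj u' v' := by
    rw [deleteEdges_pair_adj]
    exact ⟨huv', by grind⟩
  have hN2 := hN1.deleteEdges {s(u', v')}
  have c2 := hN1.cov_deleteEdges huv1
  have d2 := hN1.card_cov_deleteEdges huv1
  set N2 := (N.deleteEdges {s(u, v)}).deleteEdges {s(u', v')} with hN2d
  have m2 : ∀ x, x ∈ cov N2 → x ≠ u ∧ x ≠ v ∧ x ≠ u' ∧ x ≠ v' := by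
    intro x hx
    rw [c2, c1] at hx
    grind
  have f1 : u ∉ cov N2 := fun h => (m2 _ h).1 rfl
  have f2 : u' ∉ cov N2 := fun h => (m2 _ h).2.2.1 rfl
  have hN3 := hN2.sup_edge huu' f1 f2
  have d3 := card_cov_sup_edge n1 f1 f2
  have m3 : ∀ x, x ∈ cov (N2 ⊔ SimpleGraph.edge u u') → x ≠ v ∧ x ≠ v' := by
    intro x hx
    obtain ⟨y, hy⟩ := mem_cov.1 hx
    rw [sup_edge_adj n1] at hy
    rcases hy with h | h
    · have := m2 x (left_mem_cov h)
      tauto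
    · grind
  have f3 : v ∉ cov (N2 ⊔ SimpleGraph.edge u u') := fun h => (m3 _ h).1 rfl
  have f4 : v' ∉ cov (N2 ⊔ SimpleGraph.edge u u') := fun h => (m3 _ h).2 rfl
  refine ⟨_, hN3.sup_edge hvv' f3 f4, ?_, fun x y => ?_⟩
  · rw [card_cov_sup_edge n2 f3 f4]
    omega
  · rw [sup_edge_adj n2, sup_edge_adj n1, hN2d, deleteEdges_pair_adj, deleteEdges_pair_adj]

/-! ### Degrees -/

lemma le_card_filter_adj {G : SimpleGraph V} [DecidableRel G.Adj] {δ : ℕ} (h : δ ≤ G.minDegree)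
    (v : V) : δ ≤ #{x | G.Adj v x} := by
  refine (h.trans (G.minDegree_le_degree v)).trans_eq ?_
  rw [← SimpleGraph.card_neighborFinset_eq_degree]
  congr 1
  ext x
  simp

/-- Deleting a matching lowers each degree by at most one. -/
lemma IsMatch.le_card_filter_sdiff_adj {G N : SimpleGraph V} (hN : IsMatch G N) {δ : ℕ} {v : V}
    (h : δ ≤ #{x | G.Adj v x}) : δ ≤ #{x | (G \ N).Adj v x} + 1 := by
  by_cases hv : v ∈ cov N
  · obtain ⟨b, hb⟩ := mem_cov.1 hv
    refine (h.trans (card_le_card ?_)).trans (card_insert_le b _)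
    intro x hx
    have := hN.unique v b x hb
    simp only [mem_insert, mem_filter, mem_univ, true_and, SimpleGraph.sdiff_adj] at hx ⊢
    grind
  · refine (h.trans (card_le_card ?_)).trans (Nat.le_succ _)
    intro x hx
    have : ¬ N.Adj v x := fun h => hv (left_mem_cov h)
    simp only [mem_filter, mem_univ, true_and, SimpleGraph.sdiff_adj] at hx ⊢
    exact ⟨hx, this⟩

lemma sdiff_adj_of_not_mem_cov {G N : SimpleGraph V} {v x : V} (hv : v ∉ cov N) :
    (G \ N).Adj v x ↔ G.Adj v x := by
  have : ¬ N.Adj v x := fun h => hv (left_mem_cov h)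
  simp [SimpleGraph.sdiff_adj, this]

lemma card_filter_le_of_subset_union {p : V → Prop} [DecidablePred p] {A B : Finset V}
    (h : ∀ x, p x → x ∈ A ∨ x ∈ B) : #{x | p x} ≤ #A + #B :=
  (card_le_card (by intro x hx; have := h x; grind)).trans (card_union_le A B)

/-! ### Removable matchings -/

/-- `N` is a matching of `G` whose deletion leaves no separation of order less than `k`. -/
def Removable (G N : SimpleGraph V) (k : ℕ) : Prop := IsMatch G N ∧ KConn (G \ N) univ k

lemma Removable.exists_isKRemovable {G N : SimpleGraph V} {k ℓ : ℕ} (hk : k < Fintype.card V)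
    (h : Removable G N k) (hℓ : 2 * ℓ ≤ #(cov N)) :
    ∃ M : G.Subgraph, IsKRemovable M k ∧ M.edgeSet.ncard = ℓ := by
  obtain ⟨N', hle, hN'm, hc⟩ := h.1.exists_card_cov_eq hℓ
  have hN' : Removable G N' k := ⟨hN'm, h.2.mono (sdiff_le_sdiff_left hle)⟩
  let M : G.Subgraph :=
    { verts := N'.support
      Adj := N'.Adj
      adj_sub := fun hab => hN'.1.le hab
      edge_vert := fun {a b} hab => ⟨b, hab⟩
      symm := N'.symm }
  have hM : M.edgeSet = N'.edgeSet := by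
    ext e
    induction e with
    | _ a b => simp [M, SimpleGraph.Subgraph.mem_edgeSet]
  have hdel : G.deleteEdges M.edgeSet = G \ N' := by
    ext a b
    rw [SimpleGraph.deleteEdges_adj, SimpleGraph.sdiff_adj, hM, SimpleGraph.mem_edgeSet]
  refine ⟨M, ⟨fun v hv => ?_, ?_⟩, ?_⟩
  · obtain ⟨w, hw⟩ := hv
    exact ⟨w, hw, fun z hz => hN'.1.unique v z w hz hw⟩
  · rw [hdel, isKConnected_iff]
    exact ⟨hk, hN'.2⟩
  · have := hN'.1.card_cov
    rw [hM]
    omega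

lemma IsKRemovable.exists_removable {G : SimpleGraph V} {M : G.Subgraph} {k : ℕ}
    (h : IsKRemovable M k) : ∃ N, Removable G N k ∧ #(cov N) = 2 * M.edgeSet.ncard := by
  obtain ⟨hM, hc⟩ := h
  have hN : IsMatch G M.spanningCoe := by
    refine ⟨M.spanningCoe_le, fun a b c hab hac => ?_⟩
    exact (hM (M.edge_vert hab)).unique hab hac
  have hE : M.spanningCoe.edgeSet = M.edgeSet := by
    ext e
    induction e with
    | _ a b => simp [SimpleGraph.Subgraph.mem_edgeSet]
  have hdel : G.deleteEdges M.edgeSet = G \ M.spanningCoe := by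
    ext a b
    rw [SimpleGraph.deleteEdges_adj, SimpleGraph.sdiff_adj, ← hE, SimpleGraph.mem_edgeSet]
  refine ⟨M.spanningCoe, ⟨hN, ?_⟩, ?_⟩
  · rw [← hdel]
    exact (isKConnected_iff.1 hc).2
  · rw [hN.card_cov, hE]

lemma exists_maximum_removable {G : SimpleGraph V} {k : ℕ} (hG : KConn G univ k) :
    ∃ N, Removable G N k ∧ ∀ N', Removable G N' k → #(cov N') ≤ #(cov N) := by
  obtain ⟨N, hN, hmax⟩ := Set.exists_max_image {N : SimpleGraph V | Removable G N k}
    (fun N => #(cov N)) (Set.toFinite _) ⟨⊥, IsMatch.bot G, by simpa using hG⟩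
  exact ⟨N, hN, hmax⟩

/-- The vertices left uncovered by a maximum removable matching `N` induce a forest: by
maximality all edges among them are essential in `G - N`, and their degrees exceed `k`. -/
lemma Removable.isForestOn {G N : SimpleGraph V} {k : ℕ} (hN : Removable G N k)
    (hmax : ∀ N', Removable G N' k → #(cov N') ≤ #(cov N))
    (hdeg : ∀ v, k < #{x | G.Adj v x}) : IsForestOn G (univ \ cov N) := by
  intro P hP hne
  have hPc : ∀ a ∈ P, a ∉ cov N := by grind
  obtain ⟨a, haP, ha⟩ := exists_essential_degree_le_one hN.2 hne (fun a ha => by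
    simp only [sdiff_adj_of_not_mem_cov (hPc a ha)]
    exact hdeg a)
  have hess : ∀ b ∈ P, G.Adj a b → Essential (G \ N) univ k a b := by
    intro b hb hab
    refine ⟨(sdiff_adj_of_not_mem_cov (hPc a haP)).2 hab, fun hcon => ?_⟩
    have h1 := hmax _ ⟨hN.1.sup_edge hab (hPc a haP) (hPc b hb), hcon.mono fun x y hxy => ?_⟩
    · rw [card_cov_sup_edge hab.ne (hPc a haP) (hPc b hb)] at h1
      omega
    · rw [deleteEdges_pair_adj, SimpleGraph.sdiff_adj] at hxy
      rw [SimpleGraph.sdiff_adj, sup_edge_adj hab.ne]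
      tauto
  exact ⟨a, haP, fun b hb c hc hab hac => ha b hb c hc (hess b hb hab) (hess c hc hac)⟩

/-- A vertex with at most one neighbour in `P` has all its other neighbours outside `P`. -/
lemma card_adj_not_mem_of_leaf {G : SimpleGraph V} {δ : ℕ} {u : V} {P : Finset V}
    (hdeg : δ ≤ #{x | G.Adj u x})
    (hleaf : ∀ b ∈ P, ∀ c ∈ P, G.Adj u b → G.Adj u c → b = c) :
    δ ≤ #{x | G.Adj u x ∧ x ∉ P} + 1 := by
  have h1 : #{x | G.Adj u x ∧ x ∈ P} ≤ 1 := by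
    rw [card_le_one]
    intro b hb c hc
    simp only [mem_filter, mem_univ, true_and] at hb hc
    exact hleaf b hb.2 c hc.2 hb.1 hc.1
  have h2 := card_filter_le_of_subset_union (p := G.Adj u)
    (A := {x | G.Adj u x ∧ x ∉ P}) (B := {x | G.Adj u x ∧ x ∈ P}) (by
      intro x hx
      simp only [mem_filter, mem_univ, true_and]
      tauto)
  omega

/-- By counting, two vertices which together have more than `#(cov N)` neighbours in `cov N` are
joined to the two ends of some edge of `N`. -/
lemma exists_adj_of_card_lt {G N : SimpleGraph V} (hN : IsMatch G N) {u w : V}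
    (h : #(cov N) < #{x | G.Adj u x ∧ x ∈ cov N} + #{x | G.Adj w x ∧ x ∈ cov N}) :
    ∃ x y, N.Adj x y ∧ G.Adj x u ∧ G.Adj y w := by
  by_contra! hcon
  -- the partner map of `N` sends the neighbours of `u` to non-neighbours of `w`
  obtain ⟨σ, hσ⟩ := exists_partner N
  have himg : #(({x | G.Adj u x ∧ x ∈ cov N} : Finset V).image σ) =
      #{x | G.Adj u x ∧ x ∈ cov N} := by
    refine card_image_of_injOn fun x hx x' hx' hxx => ?_
    simp only [coe_filter, mem_univ, true_and, Set.mem_ofPred_eq] at hx hx'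
    have e1 := (hσ x hx.2).symm
    have e2 := (hσ x' hx'.2).symm
    rw [← hxx] at e2
    exact hN.unique _ _ _ e1 e2
  have hdisj : Disjoint (({x | G.Adj u x ∧ x ∈ cov N} : Finset V).image σ)
      ({x | G.Adj w x ∧ x ∈ cov N} : Finset V) := by
    rw [disjoint_left]
    intro y hy hwy
    simp only [mem_image, mem_filter, mem_univ, true_and] at hy hwy
    obtain ⟨x, hx, rfl⟩ := hy
    exact hcon x _ (hσ x hx.2) hx.1.symm hwy.1.symm
  have hsub : ({x | G.Adj u x ∧ x ∈ cov N} : Finset V).image σ ∪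
      ({x | G.Adj w x ∧ x ∈ cov N} : Finset V) ⊆ cov N := by
    intro y hy
    simp only [mem_union, mem_image, mem_filter, mem_univ, true_and] at hy
    rcases hy with ⟨x, hx, rfl⟩ | hy
    · exact right_mem_cov (hσ x hx.2)
    · exact hy.2
  have h2 := card_le_card hsub
  rw [card_union_of_disjoint hdisj, himg] at h2
  omega

/-- A graph of minimum degree at least `δ` on at least `2δ` vertices has a matching covering at
least `2δ` vertices: otherwise some path `u x y w`, with `xy` in a maximum matching and `u`, `w`
not covered, is augmenting. -/
lemma exists_isMatch_of_degree {G : SimpleGraph V} {δ : ℕ} (hdeg : ∀ v, δ ≤ #{x | G.Adj v x})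
    (hcard : 2 * δ ≤ Fintype.card V) : ∃ N, IsMatch G N ∧ 2 * δ ≤ #(cov N) := by
  obtain ⟨N, hN, hmax⟩ := Set.exists_max_image {N : SimpleGraph V | IsMatch G N}
    (fun N => #(cov N)) (Set.toFinite _) ⟨⊥, IsMatch.bot G⟩
  simp only [Set.mem_ofPred_eq] at hN hmax
  refine ⟨N, hN, ?_⟩
  by_contra! hlt
  have he := hN.card_cov
  have h1 : 1 < #((cov N)ᶜ) := by rw [card_compl]; omega
  obtain ⟨u, hu, w, hw, huw⟩ := one_lt_card.1 h1
  rw [mem_compl] at hu hw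
  have hcovered : ∀ u v, u ∉ cov N → G.Adj u v → v ∈ cov N := by
    intro u v hu huv
    by_contra hv
    have := hmax _ (hN.sup_edge huv hu hv)
    rw [card_cov_sup_edge huv.ne hu hv] at this
    omega
  have hfull : ∀ u, u ∉ cov N → δ ≤ #{x | G.Adj u x ∧ x ∈ cov N} := by
    intro u hu
    refine (hdeg u).trans (card_le_card fun x hx => ?_)
    simp only [mem_filter, mem_univ, true_and] at hx ⊢
    exact ⟨hx, hcovered u x hu hx⟩
  have h2 := hfull u hu
  have h3 := hfull w hw
  obtain ⟨x, y, hxy, hxu, hyw⟩ := exists_adj_of_card_lt (G := G) hN (u := u) (w := w) (by omega)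
  obtain ⟨N', hN', hc, -⟩ := hN.exchange hxy hu hw huw hxu hyw
  have := hmax _ hN'
  omega

/-! ### Maximum removable matchings -/

/-- If a maximum removable matching `N` admits an augmenting path `u x y w` in `G`, then the
augmented matching `N'` is not removable, so some separation of `G - N'` splits one of the two new
edges. -/
lemma Removable.exists_isSep_of_exchange {G N : SimpleGraph V} {k : ℕ} (hN : Removable G N k)
    (hmax : ∀ N', Removable G N' k → #(cov N') ≤ #(cov N)) {x y u w : V} (hxy : N.Adj x y)
    (hu : u ∉ cov N) (hw : w ∉ cov N) (huw : u ≠ w) (hxu : G.Adj x u) (hyw : G.Adj y w) :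
    ∃ N', IsMatch G N' ∧ N'.Adj x u ∧ N'.Adj y w ∧
      (∀ p b, N'.Adj p b → p ∈ cov N ∨ p = u ∨ p = w) ∧
      ∃ A S, IsSep (G \ N') univ k A S ∧
        (x ∈ A ∧ u ∉ A ∧ u ∉ S ∨ y ∈ A ∧ w ∉ A ∧ w ∉ S) := by
  obtain ⟨N', hN', hc, hadj⟩ := hN.1.exchange hxy hu hw huw hxu hyw
  have hnot : ¬ KConn (G \ N') univ k := fun h => by
    have := hmax N' ⟨hN', h⟩
    omega
  refine ⟨N', hN', (hadj _ _).2 (by tauto), (hadj _ _).2 (by tauto), ?_, ?_⟩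
  · intro p b hpb
    have h1 := left_mem_cov hxy
    have h2 := right_mem_cov hxy
    rcases (hadj p b).1 hpb with h | h | h
    · exact Or.inl (left_mem_cov h.1)
    · grind
    · grind
  · unfold KConn at hnot
    push Not at hnot
    obtain ⟨Y, Z, hs⟩ := hnot
    have hcl : ¬ ∀ p ∈ Y, ∀ q ∈ univ, (G \ N).Adj p q → q ∈ Y ∨ q ∈ Z := fun hcl =>
      hN.2 Y Z ⟨hs.subset, hs.nonempty, hs.disjoint, hs.card_lt, hcl, hs.exists_not_mem⟩
    push Not at hcl
    obtain ⟨p, hp, q, hq, hpq, hqY, hqZ⟩ := hcl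
    have hpZ := disjoint_left.1 hs.disjoint hp
    have hpq' : N'.Adj p q := by
      by_contra hcon
      have := hs.closed p hp q hq ⟨hpq.1, hcon⟩
      tauto
    have hns : ¬ N.Adj p q := hpq.2
    have h1 := (hadj p q).1 hpq'
    have hcompl := hs.compl
    by_cases hcase : p = x ∧ q = u ∨ p = y ∧ q = w
    · exact ⟨Y, Z, hs, by grind⟩
    · exact ⟨_, Z, hcompl, by grind⟩

lemma Removable.le_card_cov_add_one {G N : SimpleGraph V} {k δ : ℕ} (hN : Removable G N k)
    (hmax : ∀ N', Removable G N' k → #(cov N') ≤ #(cov N)) (hk : k < δ)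
    (hdeg : ∀ v, δ ≤ #{x | G.Adj v x}) (hcov : #(cov N) < Fintype.card V) : δ ≤ #(cov N) + 1 := by
  have hF := hN.isForestOn hmax (fun v => hk.trans_le (hdeg v))
  have hne : (univ \ cov N).Nonempty := by
    rw [← card_pos, ← compl_eq_univ_sdiff, card_compl]
    omega
  obtain ⟨a, ha, hl⟩ := hF _ Subset.rfl hne
  refine (card_adj_not_mem_of_leaf (hdeg a) hl).trans (Nat.succ_le_succ (card_le_card ?_))
  intro z hz
  simpa using (mem_filter.1 hz).2.2

/-- The degree count behind the bound `(δ + 1) / 2`: if `u` is adjacent to all but at most one of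
the at most `δ` covered vertices, a separation of `G - N'` which splits an edge `xu` of `N'` cannot
exist. Its side `A ∋ x` contains at most two covered vertices, hence is too small for the degrees
of the leaves of the forest on its uncovered vertices. -/
lemma false_of_isSep_of_leaf {G N N' : SimpleGraph V} {k δ : ℕ} (hk : 2 ≤ k) (hδ : 3 * k - 1 ≤ δ)
    (hdeg : ∀ v, δ ≤ #{x | G.Adj v x}) (hF : IsForestOn G (univ \ cov N)) (hcov : #(cov N) ≤ δ)
    (hN' : IsMatch G N') {x u w : V} (hxu : N'.Adj x u)
    (hleaf : δ ≤ #{z | G.Adj u z ∧ z ∈ cov N} + 1)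
    (hcov' : ∀ p b, N'.Adj p b → p ∈ cov N ∨ p = u ∨ p = w) {A S : Finset V}
    (hs : IsSep (G \ N') univ k A S) (hxA : x ∈ A) (huA : u ∉ A) (huS : u ∉ S) : False := by
  have hS := hs.card_lt
  have hcl : ∀ p ∈ A, ∀ q, G.Adj p q → ¬ N'.Adj p q → q ∈ A ∨ q ∈ S :=
    fun p hp q h1 h2 => hs.closed p hp q (mem_univ _) ⟨h1, h2⟩
  have hX : #(A ∩ cov N) ≤ 2 := by
    have h1 : #{z ∈ cov N | G.Adj u z} + #{z ∈ cov N | ¬ G.Adj u z} = #(cov N) :=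
      card_filter_add_card_filter_not _
    have h2 : #{z ∈ cov N | G.Adj u z} = #{z | G.Adj u z ∧ z ∈ cov N} := by
      congr 1; ext z; simp [and_comm]
    have h3 : A ∩ cov N ⊆ insert x {z ∈ cov N | ¬ G.Adj u z} := by
      intro z hz
      have h4 := hN'.unique u x z hxu.symm
      have h5 := hcl z (by grind) u
      have h6 := G.adj_comm u z
      have h7 := N'.adj_comm u z
      grind
    have h4 := card_le_card h3
    have h5 := card_insert_le x {z ∈ cov N | ¬ G.Adj u z}
    omega
  have hA : #A ≤ #(A \ cov N) + #(A ∩ cov N) := by rw [card_sdiff_add_card_inter]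
  rcases Nat.lt_or_ge #(A \ cov N) 2 with h2 | h2
  · have h3 := hN'.le_card_filter_sdiff_adj (hdeg x)
    have h4 : #{z | (G \ N').Adj x z} ≤ #(A.erase x) + #S :=
      card_filter_le_of_subset_union (A := A.erase x) (B := S) fun z hz => by
        have := hs.closed x hxA z (mem_univ _) hz
        have := hz.ne
        grind
    rw [card_erase_of_mem hxA] at h4
    omega
  · obtain ⟨p, hp, q, hq, hpq, hlp, hlq⟩ :=
      hF.exists_two_leaves (P := A \ cov N) (by grind) h2
    obtain ⟨r, hr, hrw, hlr⟩ : ∃ r ∈ A \ cov N, r ≠ w ∧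
        ∀ b ∈ A \ cov N, ∀ c ∈ A \ cov N, G.Adj r b → G.Adj r c → b = c := by
      by_cases hpw : p = w
      · exact ⟨q, hq, by grind, hlq⟩
      · exact ⟨p, hp, hpw, hlp⟩
    have h3 := card_adj_not_mem_of_leaf (hdeg r) hlr
    have h4 : #{z | G.Adj r z ∧ z ∉ A \ cov N} ≤ #(A ∩ cov N) + #S :=
      card_filter_le_of_subset_union (p := fun z => G.Adj r z ∧ z ∉ A \ cov N)
        (A := A ∩ cov N) (B := S) fun z hz => by
        have := hcl r (by grind) z hz.1
        have := hcov' r z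
        grind
    omega

lemma exists_removable_of_three_mul_le {G : SimpleGraph V} {k δ : ℕ} (hk : 2 ≤ k)
    (hδ : 3 * k - 1 ≤ δ) (hG : KConn G univ k) (hdeg : ∀ v, δ ≤ #{x | G.Adj v x})
    (hcard : 2 * δ ≤ Fintype.card V) : ∃ N, Removable G N k ∧ 2 * (δ / 2 + 1) ≤ #(cov N) := by
  obtain ⟨N, hN, hmax⟩ := exists_maximum_removable hG
  refine ⟨N, hN, ?_⟩
  by_contra! hlt
  have he := hN.1.card_cov
  have hcov : #(cov N) ≤ δ := by omega
  have hF := hN.isForestOn hmax (fun v => (show k < δ by omega).trans_le (hdeg v))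
  obtain ⟨u, hu, w, hw, huw, hlu, hlw⟩ := hF.exists_two_leaves Subset.rfl (by
    rw [← compl_eq_univ_sdiff, card_compl]
    omega)
  have h1 := card_adj_not_mem_of_leaf (hdeg u) hlu
  have h2 := card_adj_not_mem_of_leaf (hdeg w) hlw
  simp only [mem_sdiff, mem_univ, true_and, not_not] at h1 h2 hu hw
  obtain ⟨x, y, hxy, hxu, hyw⟩ := exists_adj_of_card_lt (G := G) hN.1 (u := u) (w := w) (by omega)
  obtain ⟨N', hN', hxu', hyw', hcov', A, S, hs, hcase⟩ :=
    hN.exists_isSep_of_exchange hmax hxy hu hw huw hxu hyw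
  rcases hcase with ⟨ha, hb, hc⟩ | ⟨ha, hb, hc⟩
  · exact false_of_isSep_of_leaf hk hδ hdeg hF hcov hN' hxu' h1 hcov' hs ha hb hc
  · exact false_of_isSep_of_leaf hk hδ hdeg hF hcov hN' hyw' h2
      (fun p b h => (hcov' p b h).imp_right Or.symm) hs ha hb hc

/-- If the maximum removable matching consists of a single edge `xy` in a `2`-connected graph of
minimum degree at least three, a separation of `G - {xu, yw}` cannot split `xu`: the side of `u`
would avoid `x`, and so would contain a second leaf of the forest, whose neighbour `x` is on the
other side. -/
lemma false_of_isSep_of_card_cov_eq_two {G N N' : SimpleGraph V}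
    (hdeg : ∀ v, 3 ≤ #{x | G.Adj v x}) (hF : IsForestOn G (univ \ cov N)) {x y u w : V}
    (hcov : ∀ z, z ∈ cov N ↔ z = x ∨ z = y) (hxy : G.Adj x y)
    (hN' : IsMatch G N') (hu : u ∉ cov N) (hxu : N'.Adj x u) (hyw : N'.Adj y w)
    (hyu : G.Adj y u) (hcov' : ∀ p b, N'.Adj p b → p ∈ cov N ∨ p = u ∨ p = w) {A S : Finset V}
    (hs : IsSep (G \ N') univ 2 A S) (hxA : x ∈ A) (huA : u ∉ A) (huS : u ∉ S) : False := by
  have hS := hs.card_lt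
  have hcl : ∀ p ∈ A, ∀ q, G.Adj p q → ¬ N'.Adj p q → q ∈ A ∨ q ∈ S :=
    fun p hp q h1 h2 => hs.closed p hp q (mem_univ _) ⟨h1, h2⟩
  have hne := hxy.ne
  have hyS : y ∈ S := by
    have h1 := hcl x hxA y hxy (fun h => by have := hN'.unique x y u h hxu; grind)
    have h2 : y ∉ A := fun hyA => by
      have := hcl y hyA u hyu (fun h => by
        have := hN'.unique u y x h.symm hxu.symm; grind)
      tauto
    tauto
  have hSy : ∀ z ∈ S, z = y := fun z hz => card_le_one.1 (by omega) z hz y hyS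
  have hc := hs.compl
  set B := univ \ (A ∪ S) with hB
  have hmB : ∀ z, z ∈ B ↔ z ∉ A ∧ z ≠ y := by
    intro z
    have := hSy z
    simp only [hB, mem_sdiff, mem_univ, true_and, mem_union]
    grind
  have huB : u ∈ B := by rw [hmB]; grind
  have hB2 : 2 ≤ #B := by
    have h3 := hN'.le_card_filter_sdiff_adj (hdeg u)
    have h4 : #{z | (G \ N').Adj u z} ≤ #(B.erase u) + #S :=
      card_filter_le_of_subset_union (A := B.erase u) (B := S) fun z hz => by
        have := hc.closed u huB z (mem_univ _) hz
        have := hz.ne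
        grind
    rw [card_erase_of_mem huB] at h4
    omega
  obtain ⟨p, hp, q, hq, hpq, hlp, hlq⟩ := hF.exists_two_leaves (P := B) (by grind) hB2
  obtain ⟨r, hr, hru, hlr⟩ : ∃ r ∈ B, r ≠ u ∧
      ∀ b ∈ B, ∀ c ∈ B, G.Adj r b → G.Adj r c → b = c := by
    by_cases hpu : p = u
    · exact ⟨q, hq, by grind, hlq⟩
    · exact ⟨p, hp, hpu, hlp⟩
  have h3 := card_adj_not_mem_of_leaf (hdeg r) hlr
  have h4 : #{z | G.Adj r z ∧ z ∉ B} ≤ #({y} : Finset V) := by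
    refine card_le_card fun z hz => ?_
    simp only [mem_filter, mem_univ, true_and] at hz
    rw [mem_singleton]
    by_cases hrz : N'.Adj r z
    · have h5 := hcov' r z hrz
      have h6 : r = w := by grind
      subst h6
      exact hN'.unique _ _ _ hrz hyw.symm
    · have h5 := hc.closed r hr z (mem_univ _) ⟨hz.1, hrz⟩
      exact hSy z (h5.resolve_left hz.2)
  rw [card_singleton] at h4
  omega

lemma exists_removable_two {G : SimpleGraph V} {k : ℕ} (hk : 2 ≤ k) (hG : KConn G univ k)
    (hdeg : ∀ v, k + 1 ≤ #{x | G.Adj v x}) (hcard : 2 * (k + 1) ≤ Fintype.card V) :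
    ∃ N, Removable G N k ∧ 2 * 2 ≤ #(cov N) := by
  obtain ⟨N, hN, hmax⟩ := exists_maximum_removable hG
  refine ⟨N, hN, ?_⟩
  by_contra! hlt
  have he := hN.1.card_cov
  have hle := hN.le_card_cov_add_one hmax (Nat.lt_succ_self k) hdeg (by omega)
  obtain rfl : k = 2 := by omega
  have hc2 : #(cov N) = 2 := by omega
  have hF := hN.isForestOn hmax hdeg
  obtain ⟨u, hu, w, hw, huw, hlu, hlw⟩ := hF.exists_two_leaves Subset.rfl (by
    rw [← compl_eq_univ_sdiff, card_compl]
    omega)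
  have h1 := card_adj_not_mem_of_leaf (hdeg u) hlu
  have h2 := card_adj_not_mem_of_leaf (hdeg w) hlw
  simp only [mem_sdiff, mem_univ, true_and, not_not] at h1 h2 hu hw
  obtain ⟨x, y, hxy, hxu, hyw⟩ := exists_adj_of_card_lt (G := G) hN.1 (u := u) (w := w) (by omega)
  have hcov : ∀ z, z ∈ cov N ↔ z = x ∨ z = y := by
    have h3 : {x, y} = cov N := eq_of_subset_of_card_le (by
      have := left_mem_cov hxy
      have := right_mem_cov hxy
      grind) (by rw [card_pair hxy.ne, hc2])
    intro z
    rw [← h3]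
    simp
  have hall : ∀ v, 3 ≤ #{x | G.Adj v x ∧ x ∈ cov N} + 1 → ∀ z ∈ cov N, G.Adj v z := by
    intro v hv z hz
    have h3 : ({x | G.Adj v x ∧ x ∈ cov N} : Finset V) = cov N :=
      eq_of_subset_of_card_le (fun t ht => (mem_filter.1 ht).2.2) (by omega)
    rw [← h3] at hz
    exact (mem_filter.1 hz).2.1
  have hxm := left_mem_cov hxy
  have hym := right_mem_cov hxy
  obtain ⟨N', hN', hxu', hyw', hcov', A, S, hs, hcase⟩ :=
    hN.exists_isSep_of_exchange hmax hxy hu hw huw hxu hyw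
  rcases hcase with ⟨ha, hb, hc⟩ | ⟨ha, hb, hc⟩
  · exact false_of_isSep_of_card_cov_eq_two hdeg hF hcov (hN.1.le hxy) hN' hu hxu' hyw'
      (hall u h1 y hym).symm hcov' hs ha hb hc
  · exact false_of_isSep_of_card_cov_eq_two hdeg hF (fun z => (hcov z).trans or_comm)
      (hN.1.le hxy).symm hN' hw hyw' hxu' (hall w h2 x hxm).symm
      (fun p b h => (hcov' p b h).imp_right Or.symm) hs ha hb hc

lemma exists_removable_one {G : SimpleGraph V} (hG : KConn G univ 1)
    (hdeg : ∀ v, 2 ≤ #{x | G.Adj v x}) (hcard : 2 * 2 ≤ Fintype.card V) :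
    ∃ N, Removable G N 1 ∧ 2 * 1 ≤ #(cov N) := by
  obtain ⟨N, hN, hmax⟩ := exists_maximum_removable hG
  refine ⟨N, hN, ?_⟩
  by_contra! hlt
  have he := hN.1.card_cov
  have hle := hN.le_card_cov_add_one hmax one_lt_two hdeg (by omega)
  omega

/-! ### Matchings of a given size with fewest separations -/

/-- The separations of `H` of order less than `k`. -/
noncomputable def seps (H : SimpleGraph V) (k : ℕ) : Finset (Finset V × Finset V) :=
  {p | IsSep H univ k p.1 p.2}

lemma mem_seps {H : SimpleGraph V} {k : ℕ} {p : Finset V × Finset V} :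
    p ∈ seps H k ↔ IsSep H univ k p.1 p.2 := by
  simp [seps]

lemma card_seps_lt {H H' : SimpleGraph V} {k : ℕ} {K S : Finset V}
    (h : ∀ Y Z, IsSep H' univ k Y Z → IsSep H univ k Y Z) (h1 : IsSep H univ k K S)
    (h2 : ¬ IsSep H' univ k K S) : #(seps H' k) < #(seps H k) := by
  refine card_lt_card (ssubset_iff_of_subset (fun p hp => ?_) |>.2 ⟨(K, S), ?_, ?_⟩)
  · exact mem_seps.2 (h _ _ (mem_seps.1 hp))
  · exact mem_seps.2 h1
  · exact fun hp => h2 (mem_seps.1 hp)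

/-- `N` is a matching of `G` such that `G - N` has as few separations of order less than `k` as
possible among all matchings of the same size. -/
structure IsSepMinimal (G N : SimpleGraph V) (k : ℕ) : Prop where
  isMatch : IsMatch G N
  card_seps_le : ∀ N', IsMatch G N' → #(cov N') = #(cov N) →
    #(seps (G \ N) k) ≤ #(seps (G \ N') k)

lemma IsMatch.exists_isSepMinimal {G N : SimpleGraph V} (hN : IsMatch G N) (k : ℕ) :
    ∃ N', IsSepMinimal G N' k ∧ #(cov N') = #(cov N) := by
  obtain ⟨N', hN', hmin⟩ := Set.exists_min_image
    {N' : SimpleGraph V | IsMatch G N' ∧ #(cov N') = #(cov N)}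
    (fun N' => #(seps (G \ N') k)) (Set.toFinite _) ⟨N, hN, rfl⟩
  exact ⟨N', ⟨hN'.1, fun N'' h1 h2 => hmin N'' ⟨h1, h2.trans hN'.2⟩⟩, hN'.2⟩

/-- If an edge `qv` of the sep-minimal matching `N` crosses a separation of `H = G - N`, replacing
`qv` by an edge `ab` that meets no other edge of `N` cannot be an improvement. Hence `ab` is
essential in `H`: some separation of `H - ab` splits it. -/
lemma IsSepMinimal.exists_isSep {G N : SimpleGraph V} {k : ℕ} (hN : IsSepMinimal G N k)
    {K S : Finset V} (hs : IsSep (G \ N) univ k K S) {q v a b : V} (hqv : N.Adj q v) (hq : q ∈ K)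
    (hvK : v ∉ K) (hvS : v ∉ S) (hab : G.Adj a b) (ha : a ∉ cov N) (hb : b ∉ cov N ∨ b = q) :
    ∃ Y Z, IsSep ((G \ N).deleteEdges {s(a, b)}) univ k Y Z ∧ a ∈ Y ∧ b ∉ Y ∧ b ∉ Z := by
  by_contra! hcon
  have hM := hN.isMatch
  have hqc := left_mem_cov hqv
  have hvc := right_mem_cov hqv
  have hN1 := hM.deleteEdges {s(q, v)}
  have c1 := hM.cov_deleteEdges hqv
  have d1 := hM.card_cov_deleteEdges hqv
  have ha1 : a ∉ cov (N.deleteEdges {s(q, v)}) := by rw [c1]; simp [ha]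
  have hb1 : b ∉ cov (N.deleteEdges {s(q, v)}) := by rw [c1]; grind
  have hN2 := hN1.sup_edge hab ha1 hb1
  have d2 := card_cov_sup_edge hab.ne ha1 hb1
  set N' := N.deleteEdges {s(q, v)} ⊔ SimpleGraph.edge a b with hN'
  have hadj : ∀ x y, N'.Adj x y ↔ (N.Adj x y ∧ ¬ (x = q ∧ y = v ∨ x = v ∧ y = q)) ∨
      (x = a ∧ y = b ∨ x = b ∧ y = a) := by
    intro x y
    rw [hN', sup_edge_adj hab.ne, deleteEdges_pair_adj]
  have hle := hN.card_seps_le N' hN2 (by omega)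
  have hlt : #(seps (G \ N') k) < #(seps (G \ N) k) := by
    refine card_seps_lt (fun Y Z hYZ => ?_) hs (fun hs' => ?_)
    · -- `ab` is not split by `(Y, Z)`
      have hanti : IsSep ((G \ N).deleteEdges {s(a, b)}) univ k Y Z := by
        refine hYZ.anti fun x y hxy => ?_
        rw [deleteEdges_pair_adj, SimpleGraph.sdiff_adj] at hxy
        rw [SimpleGraph.sdiff_adj, hadj]
        tauto
      have h1 := hcon Y Z hanti
      have h2 := hcon _ Z hanti.compl
      refine ⟨hYZ.subset, hYZ.nonempty, hYZ.disjoint, hYZ.card_lt, fun y hy x hx hyx => ?_,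
        hYZ.exists_not_mem⟩
      have h3 := disjoint_left.1 hYZ.disjoint
      have h4 := hanti.closed y hy x hx
      rw [deleteEdges_pair_adj] at h4
      simp only [mem_sdiff, mem_univ, true_and, mem_union] at h2
      grind
    · have h1 := hs'.closed q hq v (mem_univ _) ⟨hM.le hqv, by rw [hadj]; grind⟩
      tauto
  omega

/-! ### Two-connected graphs -/

/-- Inclusion-minimal sides of separations, with a smallest separator. -/
lemma IsSep.exists_minimal {H : SimpleGraph V} {k : ℕ} {K₀ S₀ : Finset V}
    (h : IsSep H univ k K₀ S₀) : ∃ K S, IsSep H univ k K S ∧ K ⊆ K₀ ∧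
      ∀ P T, IsSep H univ k P T → P ⊆ K → 2 * #K + #S ≤ 2 * #P + #T := by
  obtain ⟨⟨K, S⟩, ⟨h1, h2⟩, hmin⟩ := Set.exists_min_image
    {p : Finset V × Finset V | IsSep H univ k p.1 p.2 ∧ p.1 ⊆ K₀}
    (fun p => 2 * #p.1 + #p.2) (Set.toFinite _) ⟨(K₀, S₀), h, Subset.rfl⟩
  exact ⟨K, S, h1, h2, fun P T hPT hPK => hmin (P, T) ⟨hPT, hPK.trans h2⟩⟩

/-- A minimal side of a separation of order at most one, together with its separator, induces a
`2`-connected graph: it is an end-block. -/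
lemma IsSep.kConn_of_minimal {H : SimpleGraph V} {K S : Finset V} (h : IsSep H univ 2 K S)
    (hmin : ∀ P T, IsSep H univ 2 P T → P ⊆ K → 2 * #K + #S ≤ 2 * #P + #T) :
    KConn H (K ∪ S) 2 := by
  have hS := h.card_lt
  have key : ∀ P T t, P ⊆ K → P.Nonempty → T ⊆ K ∪ S → Disjoint P T → #T < 2 →
      (∀ y ∈ P, ∀ x ∈ K ∪ S, H.Adj y x → x ∈ P ∨ x ∈ T) → t ∈ K ∪ S → t ∉ P → t ∉ T → False := by
    intro P T t hPK hP hT hdis hTc hcl ht htP htT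
    have hsep : IsSep H univ 2 P T := by
      refine ⟨subset_univ _, hP, hdis, hTc, fun y hy x hx hyx => ?_, ⟨t, mem_univ _, htP, htT⟩⟩
      have := h.closed y (hPK hy) x hx hyx
      exact hcl y hy x (mem_union.2 this) hyx
    have h1 := hmin P T hsep hPK
    by_cases hPe : P = K
    · subst hPe
      have htS : t ∈ S := by grind
      have h2 : T ⊆ S.erase t := by
        intro z hz
        have h3 := hT hz
        have h4 := disjoint_left.1 hdis
        grind
      have h3 := card_le_card h2
      rw [card_erase_of_mem htS] at h3
      have := card_pos.2 ⟨t, htS⟩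
      omega
    · have := card_lt_card (hPK.ssubset_of_ne hPe)
      omega
  intro Y Z hs
  have hd := disjoint_left.1 hs.disjoint
  have hZ : #(Z ∩ (K ∪ S)) < 2 := (card_le_card inter_subset_left).trans_lt hs.card_lt
  obtain ⟨t, ht, htY, htZ⟩ := hs.exists_not_mem
  by_cases hYK : Y ⊆ K
  · refine key Y (Z ∩ (K ∪ S)) t hYK hs.nonempty inter_subset_right ?_ hZ ?_ ht htY (by grind)
    · rw [disjoint_left]; grind
    · intro y hy x hx hyx
      have := hs.closed y hy x hx hyx
      grind
  · obtain ⟨s, hsY, hsK⟩ := not_subset.1 hYK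
    have hsS : s ∈ S := by have := hs.subset hsY; grind
    have hSs : ∀ z ∈ S, z = s := fun z hz => card_le_one.1 (by omega) z hz s hsS
    have hc := hs.compl
    refine key _ (Z ∩ (K ∪ S)) s ?_ hc.nonempty inter_subset_right ?_ hZ ?_
      (hs.subset hsY) (by grind) (by grind)
    · intro z hz
      have := hSs z
      grind
    · rw [disjoint_left]; grind
    · intro y hy x hx hyx
      have := hc.closed y hy x hx hyx
      grind

/-- For a sep-minimal matching `N`, an end-block `H[K ∪ S]` of `H = G - N` has at least `δ - 1`
covered vertices in `K`. Otherwise let `W` be the set of uncovered vertices of `K` and `Q` the set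
of ends in `K` of edges of `N` leaving `K ∪ S`. All edges of `H` between `W` and `W ∪ Q` are
essential, so they form a forest by Mader's theorem; but the degrees make the leaves of `H[W]`
adjacent to all of `Q`, which forces a cycle. -/
lemma IsSepMinimal.le_card_inter_cov {G N : SimpleGraph V} {δ : ℕ} (hδ : 4 ≤ δ)
    (hG : KConn G univ 2) (hdeg : ∀ v, δ ≤ #{x | G.Adj v x}) (hN : IsSepMinimal G N 2)
    {K S : Finset V} (hs : IsSep (G \ N) univ 2 K S)
    (hmin : ∀ P T, IsSep (G \ N) univ 2 P T → P ⊆ K → 2 * #K + #S ≤ 2 * #P + #T) :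
    δ ≤ #(K ∩ cov N) + 1 := by
  by_contra! hlt
  set H := G \ N with hH
  have hKS := hs.kConn_of_minimal hmin
  have hS := hs.card_lt
  have hd := disjoint_left.1 hs.disjoint
  set W := K \ cov N with hW
  set Q : Finset V := {q ∈ K | ∃ v, N.Adj q v ∧ v ∉ K ∧ v ∉ S} with hQ
  have hQne : 1 ≤ #Q := by
    rw [Nat.one_le_iff_ne_zero, card_ne_zero]
    by_contra hne
    rw [not_nonempty_iff_eq_empty] at hne
    refine hG K S ⟨hs.subset, hs.nonempty, hs.disjoint, hS, fun y hy x hx hyx => ?_,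
      hs.exists_not_mem⟩
    by_contra! hx'
    have h1 : N.Adj y x := by
      by_contra hno
      have := hs.closed y hy x hx ⟨hyx, hno⟩
      tauto
    have h2 : y ∈ Q := mem_filter.2 ⟨hy, x, h1, hx'⟩
    rw [hne] at h2
    exact absurd h2 (notMem_empty _)
  have hQc : Q ⊆ K ∩ cov N := by
    intro q hq
    obtain ⟨h1, v, h2, -⟩ := mem_filter.1 hq
    exact mem_inter.2 ⟨h1, left_mem_cov h2⟩
  have hdegH : ∀ a, δ ≤ #{x | H.Adj a x} + 1 := fun a =>
    hN.isMatch.le_card_filter_sdiff_adj (hdeg a)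
  have hK : δ ≤ #K + 1 := by
    obtain ⟨a, ha⟩ := hs.nonempty
    have h1 := hdegH a
    have h2 : #{z | H.Adj a z} ≤ #(K.erase a) + #S :=
      card_filter_le_of_subset_union (A := K.erase a) (B := S) fun z hz => by
        have := hs.closed a ha z (mem_univ _) hz
        have := hz.ne
        grind
    have h3 := card_pos.2 hs.nonempty
    rw [card_erase_of_mem ha] at h2
    omega
  have hWne : 1 ≤ #W := by
    have : #W + #(K ∩ cov N) = #K := card_sdiff_add_card_inter _ _
    omega
  have hWQ : ∀ w ∈ W, #Q + 1 ≤ #{x ∈ W ∪ Q | H.Adj w x} := by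
    intro w hw
    have h1 : δ ≤ #{x | H.Adj w x} := by
      simp only [hH, sdiff_adj_of_not_mem_cov (show w ∉ cov N by grind)]
      exact hdeg w
    have h2 : #{x | H.Adj w x} ≤ #{x ∈ W ∪ Q | H.Adj w x} + #((K ∩ cov N) \ Q ∪ S) :=
      card_filter_le_of_subset_union (A := {x ∈ W ∪ Q | H.Adj w x})
        (B := (K ∩ cov N) \ Q ∪ S) fun z hz => by
        have := hs.closed w (by grind) z (mem_univ _) hz
        grind
    have h3 := card_union_le ((K ∩ cov N) \ Q) S
    have h4 := card_sdiff_add_card_eq_card hQc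
    omega
  have hess : ∀ a ∈ W, ∀ b ∈ W ∪ Q, H.Adj a b → Essential H (K ∪ S) 2 a b := by
    intro a ha b hb hab
    refine ⟨hab, fun hcon => ?_⟩
    obtain ⟨q, hqQ, hbq⟩ : ∃ q ∈ Q, b ∉ cov N ∨ b = q := by
      obtain ⟨q, hq⟩ := card_pos.1 hQne
      by_cases hbQ : b ∈ Q
      · exact ⟨b, hbQ, Or.inr rfl⟩
      · exact ⟨q, hq, Or.inl (by grind)⟩
    obtain ⟨hqK, v, hqv, hvK, hvS⟩ := mem_filter.1 hqQ
    obtain ⟨Y, Z, hYZ, haY, hbY, hbZ⟩ :=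
      hN.exists_isSep hs hqv hqK hvK hvS hab.1 (by grind) hbq
    have h1 := disjoint_left.1 hYZ.disjoint
    refine hcon (Y ∩ (K ∪ S)) Z ⟨inter_subset_right, ⟨a, by grind⟩, ?_, hYZ.card_lt, ?_,
      ⟨b, by grind, by grind, hbZ⟩⟩
    · rw [disjoint_left]; grind
    · intro y hy x hx hyx
      have := hYZ.closed y (by grind) x (mem_univ _) hyx
      grind
  have hdegK : ∀ a ∈ K, 2 < #{x ∈ K ∪ S | H.Adj a x} := by
    intro a ha
    have h1 := hdegH a
    have h2 : #{x | H.Adj a x} ≤ #{x ∈ K ∪ S | H.Adj a x} := by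
      refine card_le_card fun z hz => ?_
      have h3 := (mem_filter.1 hz).2
      have := hs.closed a ha z (mem_univ _) h3
      exact mem_filter.2 ⟨mem_union.2 this, h3⟩
    omega
  have hforest : IsForestOn H W := by
    intro P hP hne
    obtain ⟨a, haP, ha⟩ := exists_essential_degree_le_one hKS hne
      (fun a ha => by convert hdegK a (by grind))
    refine ⟨a, haP, fun b hb c hc hab hac => ha b hb c hc ?_ ?_⟩
    · exact hess a (hP haP) b (by grind) hab
    · exact hess a (hP haP) c (by grind) hac
  have hW2 : 2 ≤ #W := by
    by_contra! hW1
    obtain ⟨w, hw⟩ := card_eq_one.1 (show #W = 1 by omega)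
    have h1 := hWQ w (by rw [hw]; simp)
    have h2 : #{x ∈ W ∪ Q | H.Adj w x} ≤ #Q := by
      refine card_le_card fun z hz => ?_
      obtain ⟨h3, h4⟩ := mem_filter.1 hz
      have := h4.ne
      rw [hw] at h3
      grind
    omega
  obtain ⟨w₁, hw₁, w₂, hw₂, hne, hl₁, hl₂⟩ := hforest.exists_two_leaves Subset.rfl hW2
  have hfull : ∀ w ∈ W, (∀ b ∈ W, ∀ c ∈ W, H.Adj w b → H.Adj w c → b = c) →
      ∀ q ∈ Q, H.Adj w q := by
    intro w hw hl q hq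
    by_contra hno
    have h1 := hWQ w hw
    have h2 : #{x ∈ W ∪ Q | H.Adj w x} ≤ #({x ∈ W | H.Adj w x} ∪ Q.erase q) := by
      refine card_le_card fun z hz => ?_
      grind
    have h3 : #{x ∈ W | H.Adj w x} ≤ 1 := by
      rw [card_le_one]
      intro b hb c hc
      exact hl b (mem_filter.1 hb).1 c (mem_filter.1 hc).1 (mem_filter.1 hb).2 (mem_filter.1 hc).2
    have h4 := card_union_le {x ∈ W | H.Adj w x} (Q.erase q)
    rw [card_erase_of_mem hq] at h4
    omega
  obtain ⟨a, haP, ha⟩ := exists_essential_degree_le_one (W := W ∪ Q) hKS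
    ⟨w₁, mem_union_left _ hw₁⟩ (fun a ha => by convert hdegK a (by grind))
  by_cases haW : a ∈ W
  · have h1 := hWQ a haW
    obtain ⟨b, hb, c, hc, hbc⟩ := one_lt_card.1 (show 1 < #{x ∈ W ∪ Q | H.Adj a x} by omega)
    obtain ⟨hb1, hb2⟩ := mem_filter.1 hb
    obtain ⟨hc1, hc2⟩ := mem_filter.1 hc
    exact hbc (ha b hb1 c hc1 (hess a haW b hb1 hb2) (hess a haW c hc1 hc2))
  · have haQ : a ∈ Q := (mem_union.1 haP).resolve_left haW
    exact hne (ha w₁ (mem_union_left _ hw₁) w₂ (mem_union_left _ hw₂)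
      (hess w₁ hw₁ a haP (hfull w₁ hw₁ hl₁ a haQ)).symm
      (hess w₂ hw₂ a haP (hfull w₂ hw₂ hl₂ a haQ)).symm)

/-- A `2`-connected graph of minimum degree at least `δ ≥ 4` on at least `2δ` vertices has a
`2`-removable matching of size `δ - 2`: two disjoint end-blocks of `G - N` would both need more
than half of the `2 (δ - 2)` covered vertices. -/
lemma exists_removable_of_two_connected {G : SimpleGraph V} {δ : ℕ} (hδ : 4 ≤ δ)
    (hG : KConn G univ 2) (hdeg : ∀ v, δ ≤ #{x | G.Adj v x})
    (hcard : 2 * δ ≤ Fintype.card V) : ∃ N, Removable G N 2 ∧ 2 * (δ - 2) ≤ #(cov N) := by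
  obtain ⟨N₀, hN₀, hc₀⟩ := exists_isMatch_of_degree hdeg hcard
  obtain ⟨N₁, -, hN₁, hc₁⟩ := hN₀.exists_card_cov_eq (ℓ := δ - 2) (by omega)
  obtain ⟨N, hN, hc⟩ := hN₁.exists_isSepMinimal 2
  refine ⟨N, ⟨hN.isMatch, fun Y Z hs => ?_⟩, by omega⟩
  obtain ⟨K, S, h1, hKY, hmin⟩ := hs.exists_minimal
  obtain ⟨K', S', h1', hKY', hmin'⟩ := hs.compl.exists_minimal
  have h2 := hN.le_card_inter_cov hδ hG hdeg h1 hmin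
  have h2' := hN.le_card_inter_cov hδ hG hdeg h1' hmin'
  have h3 : #(K ∩ cov N ∪ K' ∩ cov N) = #(K ∩ cov N) + #(K' ∩ cov N) :=
    card_union_of_disjoint (by rw [disjoint_left]; grind)
  have h4 : #(K ∩ cov N ∪ K' ∩ cov N) ≤ #(cov N) := card_le_card (by grind)
  omega

/-! ### Connected graphs -/

/-- Let `K` be a union of components of `H = G - N` with at most `δ` covered vertices, for a
sep-minimal matching `N` that has an edge leaving `K`. A minimal nonempty set `D` within `D₀ ⊆ K`
which at most one edge of `H` leaves contains no bridges of `H`. So every edge in `D` at an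
uncovered vertex ends in the set of vertices of `K` matched within `K`, which `D` thus contains,
or else `D` consists of all covered vertices of `K`. -/
lemma IsSepMinimal.exists_end {G N : SimpleGraph V} {δ : ℕ} (hδ : 3 ≤ δ)
    (hdeg : ∀ v, δ ≤ #{x | G.Adj v x}) (hN : IsSepMinimal G N 1) {K : Finset V}
    (hs : IsSep (G \ N) univ 1 K ∅) (hKc : #(K ∩ cov N) ≤ δ) {q₀ v₀ : V} (hq₀ : q₀ ∈ K)
    (hv₀ : v₀ ∉ K) (hqv : N.Adj q₀ v₀) {D₀ : Finset V} (hD₀K : D₀ ⊆ K) (hD₀ : D₀.Nonempty)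
    (hbd : ∃ p p', ∀ d ∈ D₀, ∀ z, z ∉ D₀ → (G \ N).Adj d z → d = p ∧ z = p') :
    ∃ D ⊆ D₀, D.Nonempty ∧
      (∃ p p', ∀ d ∈ D, ∀ z, z ∉ D → (G \ N).Adj d z → d = p ∧ z = p') ∧
      (((∃ d ∈ D, ∃ z, z ∉ D ∧ (G \ N).Adj d z) ∧ (∃ i ∈ D, ∃ j ∈ K, N.Adj i j) ∧
        ∀ i ∈ K, ∀ j ∈ K, N.Adj i j → i ∈ D) ∨ (D = K ∩ cov N ∧ #D = δ)) := by
  obtain ⟨D, ⟨hDD₀, hD, p, p', hp⟩, hmin⟩ := Set.exists_min_image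
    {D : Finset V | D ⊆ D₀ ∧ D.Nonempty ∧
      ∃ p p', ∀ d ∈ D, ∀ z, z ∉ D → (G \ N).Adj d z → d = p ∧ z = p'}
    (fun D => #D) (Set.toFinite _) ⟨D₀, Subset.rfl, hD₀, hbd⟩
  have hDK := hDD₀.trans hD₀K
  have hmin' : ∀ D' ⊆ D, D'.Nonempty →
      (∃ p p', ∀ d ∈ D', ∀ z, z ∉ D' → (G \ N).Adj d z → d = p ∧ z = p') → D' = D :=
    fun D' h1 h2 h3 => eq_of_subset_of_card_le h1 (hmin D' ⟨h1.trans hDD₀, h2, h3⟩)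
  refine ⟨D, hDD₀, hD, ⟨p, p', hp⟩, ?_⟩
  set H := G \ N with hH
  have hdegH : ∀ a, δ ≤ #{x | H.Adj a x} + 1 := fun a =>
    hN.isMatch.le_card_filter_sdiff_adj (hdeg a)
  -- no edge inside `D` is a bridge, so none can be exchanged for an edge of `N` leaving `K`
  have hnone : ∀ a ∈ D, ∀ b ∈ D, a ∉ cov N → H.Adj a b → b ∈ cov N ∧ ∀ v, N.Adj b v → v ∈ K := by
    intro a ha b hb hac hab
    by_contra hcon
    obtain ⟨q, v, hqv, hqK, hvK, hbq⟩ : ∃ q v, N.Adj q v ∧ q ∈ K ∧ v ∉ K ∧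
        (b ∉ cov N ∨ b = q) := by
      by_cases hbc : b ∈ cov N
      · push Not at hcon
        obtain ⟨v, hv, hvK⟩ := hcon hbc
        exact ⟨b, v, hv, hDK hb, hvK, Or.inr rfl⟩
      · exact ⟨q₀, v₀, hqv, hq₀, hv₀, Or.inl hbc⟩
    obtain ⟨Y, Z, hYZ, haY, hbY, hbZ⟩ :=
      hN.exists_isSep hs hqv hqK hvK (notMem_empty _) hab.1 hac hbq
    have hZ : Z = ∅ := card_eq_zero.1 (by have := hYZ.card_lt; omega)
    subst hZ
    have hcl : ∀ y ∈ Y, ∀ x, x ∉ Y → H.Adj y x → y = a ∧ x = b := by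
      intro y hy x hx hyx
      have h1 := hYZ.closed y hy x (mem_univ _)
      rw [deleteEdges_pair_adj] at h1
      grind
    by_cases hpY : p ∈ Y
    · have h1 := hmin' (D \ Y) sdiff_subset ⟨b, by grind⟩ ⟨b, a, fun d hd z hz hdz => by
        have h2 := hp d (by grind) z
        have h3 := hcl z
        have h4 := hdz.symm
        grind⟩
      rw [← h1] at ha
      grind
    · have h1 := hmin' (D ∩ Y) inter_subset_left ⟨a, by grind⟩ ⟨a, b, fun d hd z hz hdz => by
        have h2 := hp d (by grind) z
        have h3 := hcl d (by grind) z
        grind⟩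
      rw [← h1] at hb
      grind
  by_cases hW : ∃ w ∈ D, w ∉ cov N
  · left
    obtain ⟨w, hwD, hwc⟩ := hW
    set I : Finset V := {i ∈ K ∩ cov N | ∃ j ∈ K, N.Adj i j} with hI
    have hIc : #I + 1 ≤ δ := by
      refine le_trans ?_ hKc
      rw [← card_insert_of_notMem (s := I) (a := q₀)]
      · refine card_le_card ?_
        have := left_mem_cov hqv
        grind
      · intro hq
        obtain ⟨-, j, hj, hqj⟩ := mem_filter.1 hq
        have := hN.isMatch.unique _ _ _ hqj hqv
        grind
    have h1 : δ ≤ #{x | H.Adj w x} := by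
      simp only [hH, sdiff_adj_of_not_mem_cov hwc]
      exact hdeg w
    have hnb : ∀ z ∈ D, H.Adj w z → z ∈ I := by
      intro z hz hwz
      obtain ⟨h2, h3⟩ := hnone w hwD z hz hwc hwz
      obtain ⟨v, hv⟩ := mem_cov.1 h2
      exact mem_filter.2 ⟨mem_inter.2 ⟨hDK hz, h2⟩, v, h3 v hv, hv⟩
    have h2 : #{x | H.Adj w x} ≤ #(I ∩ D) + #({p'} : Finset V) :=
      card_filter_le_of_subset_union (A := I ∩ D) (B := {p'}) fun z hz => by
        have h3 := hnb z
        have h4 := hp w hwD z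
        grind
    rw [card_singleton] at h2
    have hID : I ∩ D = I := eq_of_subset_of_card_le inter_subset_left (by omega)
    refine ⟨?_, ?_, ?_⟩
    · by_contra! hcon
      have h3 : #{x | H.Adj w x} ≤ #I := by
        refine card_le_card fun z hz => ?_
        have h4 := (mem_filter.1 hz).2
        exact hnb z (by by_contra h5; exact hcon w hwD z h5 h4) h4
      omega
    · obtain ⟨i, hi⟩ := card_pos.1 (show 0 < #I by rw [hID] at h2; omega)
      obtain ⟨-, j, hj⟩ := mem_filter.1 hi
      exact ⟨i, by rw [← hID] at hi; exact (mem_inter.1 hi).2, j, hj⟩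
    · intro i hi j hj hij
      have h3 : i ∈ I := mem_filter.2 ⟨mem_inter.2 ⟨hi, left_mem_cov hij⟩, j, hj, hij⟩
      rw [← hID] at h3
      exact (mem_inter.1 h3).2
  · right
    push Not at hW
    have hDc : D ⊆ K ∩ cov N := fun d hd => mem_inter.2 ⟨hDK hd, hW d hd⟩
    obtain ⟨d, hd, hdp⟩ : ∃ d ∈ D, d ≠ p := by
      by_contra! hcon
      obtain ⟨d, hd⟩ := hD
      have h1 := hdegH d
      have h2 : #{x | H.Adj d x} ≤ #({p'} : Finset V) := by
        refine card_le_card fun z hz => ?_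
        have h3 := (mem_filter.1 hz).2
        have h4 := hp d hd z
        have h5 := hcon z
        have h6 := hcon d hd
        have h7 := h3.ne
        grind
      rw [card_singleton] at h2
      omega
    have h1 := hdegH d
    have h2 : #{x | H.Adj d x} ≤ #(D.erase d) := by
      refine card_le_card fun z hz => ?_
      have h3 := (mem_filter.1 hz).2
      have h4 := hp d hd z
      have h5 := h3.ne
      grind
    rw [card_erase_of_mem hd] at h2
    have h3 := card_le_card hDc
    exact ⟨eq_of_subset_of_card_le hDc (by omega), by omega⟩

/-- The covered vertices of a union `K` of components of `G - N` with at most `δ` of them form a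
clique of `δ` vertices matched to vertices outside `K`: otherwise two disjoint ends could be found
in `K`. -/
lemma IsSepMinimal.isClique_of_isSep {G N : SimpleGraph V} {δ : ℕ} (hδ : 3 ≤ δ)
    (hG : KConn G univ 1) (hdeg : ∀ v, δ ≤ #{x | G.Adj v x}) (hN : IsSepMinimal G N 1)
    {K : Finset V} (hs : IsSep (G \ N) univ 1 K ∅) (hKc : #(K ∩ cov N) ≤ δ) :
    #(K ∩ cov N) = δ ∧ (∀ a ∈ K ∩ cov N, ∀ b ∈ K ∩ cov N, a ≠ b → (G \ N).Adj a b) ∧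
      ∀ a ∈ K, ∀ b, N.Adj a b → b ∉ K := by
  obtain ⟨q₀, v₀, hq₀, hv₀, hqv⟩ : ∃ q v, q ∈ K ∧ v ∉ K ∧ N.Adj q v := by
    by_contra! hcon
    refine hG K ∅ ⟨hs.subset, hs.nonempty, hs.disjoint, hs.card_lt, fun y hy x hx hyx => ?_,
      hs.exists_not_mem⟩
    by_contra! hx'
    have := hs.closed y hy x hx ⟨hyx, hcon y x hy hx'.1⟩
    tauto
  have hcl : ∀ y ∈ K, ∀ x, (G \ N).Adj y x → x ∈ K := fun y hy x hyx => by
    have := hs.closed y hy x (mem_univ _) hyx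
    simpa using this
  obtain ⟨D, hDK, hD, ⟨p, p', hp⟩, hcase⟩ := hN.exists_end hδ hdeg hs hKc hq₀ hv₀ hqv
    Subset.rfl hs.nonempty ⟨q₀, q₀, fun d hd z hz hdz => absurd (hcl d hd z hdz) hz⟩
  have hclosed : ∀ d ∈ D, ∀ z, (G \ N).Adj d z → z ∈ D := by
    by_contra! hopen
    obtain ⟨d, hd, z, hdz, hz⟩ := hopen
    obtain ⟨D', hDK', hD', -, hcase'⟩ := hN.exists_end hδ hdeg hs hKc hq₀ hv₀ hqv
      (D₀ := K \ D) sdiff_subset ⟨z, by have := hcl d (hDK hd) z hdz; grind⟩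
      ⟨p', p, fun a ha b hb hab => by
        have h1 := hcl a (by grind) b hab
        have h2 := hp b (by grind) a (by grind) hab.symm
        exact ⟨h2.2, h2.1⟩⟩
    have hcov := fun i j (h : N.Adj i j) => left_mem_cov h
    rcases hcase with ⟨-, ⟨i, hi, j, hj, hij⟩, h2⟩ | ⟨h1, h2⟩ <;>
      rcases hcase' with ⟨-, ⟨i', hi', j', hj', hij'⟩, h2'⟩ | ⟨h1', h2'⟩
    · have := h2' i (hDK hi) j hj hij
      grind
    · have h3 : i ∈ D' := by
        rw [h1']
        exact mem_inter.2 ⟨hDK hi, hcov i j hij⟩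
      exact (mem_sdiff.1 (hDK' h3)).2 hi
    · have := hcov i' j' hij'
      grind
    · obtain ⟨x, hx⟩ := hD
      grind
  obtain ⟨h1, h2⟩ : D = K ∩ cov N ∧ #D = δ := by
    rcases hcase with ⟨⟨d, hd, z, hz, hdz⟩, -⟩ | h
    · exact absurd (hclosed d hd z hdz) hz
    · exact h
  have hclique : ∀ a ∈ D, ∀ b ∈ D, a ≠ b → (G \ N).Adj a b := by
    intro a ha b hb hab
    have h3 := hN.isMatch.le_card_filter_sdiff_adj (hdeg a)
    have h4 : ({x | (G \ N).Adj a x} : Finset V) ⊆ D.erase a := fun z hz => by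
      have h5 := (mem_filter.1 hz).2
      have := h5.ne
      have := hclosed a ha z h5
      grind
    have h5 := eq_of_subset_of_card_le h4 (by rw [card_erase_of_mem ha]; omega)
    have h6 : b ∈ D.erase a := mem_erase.2 ⟨hab.symm, hb⟩
    rw [← h5] at h6
    exact (mem_filter.1 h6).2
  rw [← h1]
  refine ⟨h2, hclique, fun a ha b hab hb => ?_⟩
  have h3 := hclique a (by rw [h1]; exact mem_inter.2 ⟨ha, left_mem_cov hab⟩) b
    (by rw [h1]; exact mem_inter.2 ⟨hb, right_mem_cov hab⟩) hab.ne
  exact h3.2 hab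

/-- A connected graph of minimum degree at least `δ ≥ 3` on at least `2δ` vertices has a
`1`-removable matching of size `δ`. If `G - N` is disconnected for a sep-minimal `N` of this size,
then `N` is a perfect matching between two cliques, and exchanging two of its edges `uv`, `u'v'`
for `uu'`, `vv'` makes `G - N` less disconnected. -/
lemma exists_removable_of_connected {G : SimpleGraph V} {δ : ℕ} (hδ : 3 ≤ δ)
    (hG : KConn G univ 1) (hdeg : ∀ v, δ ≤ #{x | G.Adj v x})
    (hcard : 2 * δ ≤ Fintype.card V) : ∃ N, Removable G N 1 ∧ 2 * δ ≤ #(cov N) := by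
  obtain ⟨N₀, hN₀, hc₀⟩ := exists_isMatch_of_degree hdeg hcard
  obtain ⟨N₁, -, hN₁, hc₁⟩ := hN₀.exists_card_cov_eq hc₀
  obtain ⟨N, hN, hc⟩ := hN₁.exists_isSepMinimal 1
  refine ⟨N, ⟨hN.isMatch, fun Y Z hs => ?_⟩, by omega⟩
  have hZ : Z = ∅ := card_eq_zero.1 (by have := hs.card_lt; omega)
  subst hZ
  obtain ⟨K, hK, hKc⟩ : ∃ K, IsSep (G \ N) univ 1 K ∅ ∧ #(K ∩ cov N) ≤ δ := by
    by_cases hY : #(Y ∩ cov N) ≤ δ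
    · exact ⟨Y, hs, hY⟩
    · refine ⟨_, hs.compl, ?_⟩
      have h1 : #((univ \ (Y ∪ ∅)) ∩ cov N) ≤ #(cov N \ (Y ∩ cov N)) := card_le_card (by grind)
      have h2 := card_sdiff_add_card_eq_card (show Y ∩ cov N ⊆ cov N from inter_subset_right)
      omega
  obtain ⟨hcK, hclK, hNK⟩ := hN.isClique_of_isSep hδ hG hdeg hK hKc
  have hK' := hK.compl
  rw [union_empty] at hK'
  have hcK' : #((univ \ K) ∩ cov N) ≤ δ := by
    have h1 : #((univ \ K) ∩ cov N) ≤ #(cov N \ (K ∩ cov N)) := card_le_card (by grind)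
    have h2 := card_sdiff_add_card_eq_card (show K ∩ cov N ⊆ cov N from inter_subset_right)
    omega
  obtain ⟨hcK', hclK', -⟩ := hN.isClique_of_isSep hδ hG hdeg hK' hcK'
  have hthird : ∀ s : Finset V, #s = δ → ∀ a b, ∃ z ∈ s, z ≠ a ∧ z ≠ b := by
    intro s hs a b
    by_contra! hcon
    have h1 : s ⊆ {a, b} := fun z hz => by have := hcon z hz; grind
    have h2 := card_le_card h1
    have h3 := card_le_two (a := a) (b := b)
    omega
  obtain ⟨u, hu⟩ := card_pos.1 (show 0 < #(K ∩ cov N) by omega)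
  obtain ⟨u', hu', huu', -⟩ := hthird _ hcK u u
  obtain ⟨v, huv⟩ := mem_cov.1 (mem_inter.1 hu).2
  obtain ⟨v', huv'⟩ := mem_cov.1 (mem_inter.1 hu').2
  have hvK := hNK u (mem_inter.1 hu).1 v huv
  have hvK' := hNK u' (mem_inter.1 hu').1 v' huv'
  have hM := hN.isMatch
  have hvv' : v ≠ v' := fun h => huu' (hM.unique v u' u (h ▸ huv'.symm) huv.symm)
  have hv : v ∈ (univ \ K) ∩ cov N := by
    have := right_mem_cov huv
    grind
  have hv' : v' ∈ (univ \ K) ∩ cov N := by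
    have := right_mem_cov huv'
    grind
  obtain ⟨z, hz, hzu, hzu'⟩ := hthird _ hcK u u'
  obtain ⟨z', hz', hzv, hzv'⟩ := hthird _ hcK' v v'
  have e1 := hclK u hu z hz hzu.symm
  have e2 := hclK z hz u' hu' hzu'
  have e3 := hclK' v hv z' hz' hzv.symm
  have e4 := hclK' z' hz' v' hv' hzv'
  have e5 := hclK u hu u' hu' huu'.symm
  have e6 := hclK' v hv v' hv' hvv'
  obtain ⟨N', hN', hcN', hadj⟩ := hM.exchange_two huv huv' e5.1 e6.1
  have hle := hN.card_seps_le N' hN' hcN'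
  have hzK : z ∈ K := (mem_inter.1 hz).1
  have hzK' : z' ∉ K := by grind
  have huK : u ∈ K := (mem_inter.1 hu).1
  have huK' : u' ∈ K := (mem_inter.1 hu').1
  have hlt : #(seps (G \ N') 1) < #(seps (G \ N) 1) := by
    refine card_seps_lt (fun Y Z hYZ => ?_) hK (fun hs' => ?_)
    · have hZ : Z = ∅ := card_eq_zero.1 (by have := hYZ.card_lt; omega)
      subst hZ
      have hcl : ∀ y ∈ Y, ∀ x, (G \ N').Adj y x → x ∈ Y := fun y hy x hyx => by
        simpa using hYZ.closed y hy x (mem_univ _) hyx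
      have g1 : (G \ N').Adj u z := ⟨e1.1, by rw [hadj]; have := e1.2; grind⟩
      have g2 : (G \ N').Adj z u' := ⟨e2.1, by rw [hadj]; have := e2.2; grind⟩
      have g3 : (G \ N').Adj v z' := ⟨e3.1, by rw [hadj]; have := e3.2; grind⟩
      have g4 : (G \ N').Adj z' v' := ⟨e4.1, by rw [hadj]; have := e4.2; grind⟩
      refine ⟨hYZ.subset, hYZ.nonempty, hYZ.disjoint, hYZ.card_lt, fun y hy x hx hyx => ?_,
        hYZ.exists_not_mem⟩
      left
      by_cases hyx' : N'.Adj y x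
      · have h1 : (y = u ∧ x = u' ∨ y = u' ∧ x = u) ∨ (y = v ∧ x = v' ∨ y = v' ∧ x = v) := by
          have := (hadj y x).1 hyx'
          have := hyx.2
          tauto
        rcases h1 with (⟨rfl, rfl⟩ | ⟨rfl, rfl⟩) | (⟨rfl, rfl⟩ | ⟨rfl, rfl⟩)
        · exact hcl _ (hcl _ hy _ g1) _ g2
        · exact hcl _ (hcl _ hy _ g2.symm) _ g1.symm
        · exact hcl _ (hcl _ hy _ g3) _ g4
        · exact hcl _ (hcl _ hy _ g4.symm) _ g3.symm
      · exact hcl y hy x ⟨hyx.1, hyx'⟩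
    · have h1 := hs'.closed u huK v (mem_univ _) ⟨hM.le huv, by rw [hadj]; grind⟩
      simp [hvK] at h1
  omega

end Fintype

/-! ### Upper bounds -/

lemma le_of_guaranteed {k δ ℓ : ℕ} (hk : k < δ) (h : Guaranteed k δ ℓ) : ℓ ≤ δ := by
  obtain ⟨M, hM, hℓ⟩ := h (Fin (2 * δ)) ⊤ (isKConnected_iff.2 ⟨by simp; omega, fun Y Z hs => by
    obtain ⟨x, hx, hxY, hxZ⟩ := hs.exists_not_mem
    obtain ⟨y, hy⟩ := hs.nonempty
    have := hs.closed y hy x hx (by rw [SimpleGraph.top_adj]; grind)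
    tauto⟩) (by simp) (by
      have : Nonempty (Fin (2 * δ)) := ⟨⟨0, by omega⟩⟩
      refine SimpleGraph.le_minDegree_of_forall_le_degree _ _ fun v => ?_
      rw [SimpleGraph.complete_graph_degree, Fintype.card_fin]
      omega)
  obtain ⟨N, -, hN⟩ := hM.exists_removable
  have := card_le_univ (cov N)
  rw [Fintype.card_fin] at this
  omega

/-- A cycle of length `k + 3`, all of whose vertices are joined to `k - 1` independent hubs. -/
def hubCycle (k : ℕ) : SimpleGraph (Fin (k - 1) ⊕ Fin (k + 2 + 1)) where
  Adj x y := match x, y with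
    | .inl _, .inl _ => False
    | .inl _, .inr _ => True
    | .inr _, .inl _ => True
    | .inr a, .inr b => b = a + 1 ∨ a = b + 1
  symm := ⟨by rintro (a | a) (b | b) h <;> grind⟩
  loopless := ⟨by
    rintro (a | a) h
    · exact h
    · have h1 : a = a + 1 := h.elim id id
      have h2 := congrArg Fin.val h1
      rw [Fin.val_add_one] at h2
      split_ifs at h2 with h3
      · rw [h3] at h2
        simp at h2
      · omega⟩

lemma val_add_one_eq {k : ℕ} (i : Fin (k + 2 + 1)) :
    ((i + 1 : Fin (k + 2 + 1)) : ℕ) = if (i : ℕ) = k + 2 then 0 else (i : ℕ) + 1 := by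
  rw [Fin.val_add_one]
  simp only [Fin.ext_iff, Fin.val_last]

/-- The hubs of `hubCycle k`. -/
def hubs (k : ℕ) : Finset (Fin (k - 1) ⊕ Fin (k + 2 + 1)) := univ.map .inl

lemma card_hubs (k : ℕ) : #(hubs k) = k - 1 := by simp [hubs]

lemma inl_mem_hubs {k : ℕ} (a : Fin (k - 1)) : Sum.inl a ∈ hubs k := by simp [hubs]

lemma inr_not_mem_hubs {k : ℕ} (a : Fin (k + 2 + 1)) : Sum.inr a ∉ hubs k := by simp [hubs]

lemma hubCycle_kConn {k : ℕ} : KConn (hubCycle k) univ k := by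
  -- a side containing a hub contains everything outside the separator
  have key : ∀ Y Z h, IsSep (hubCycle k) univ k Y Z → Sum.inl h ∈ Y → False := by
    intro Y Z h hs hY
    have hrim : ∀ r, Sum.inr r ∈ Y ∨ Sum.inr r ∈ Z := fun r =>
      hs.closed _ hY (Sum.inr r) (mem_univ _) trivial
    obtain ⟨r, hr⟩ : ∃ r, Sum.inr r ∉ Z := by
      by_contra! hcon
      have h1 : (univ : Finset (Fin (k + 2 + 1))).map .inr ⊆ Z := by
        intro x hx
        obtain ⟨r, -, rfl⟩ := mem_map.1 hx
        exact hcon r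
      have h2 := card_le_card h1
      rw [card_map, card_univ, Fintype.card_fin] at h2
      have := hs.card_lt
      omega
    obtain ⟨x, -, hxY, hxZ⟩ := hs.exists_not_mem
    rcases x with g | s
    · have := hs.closed _ ((hrim r).resolve_right hr) (Sum.inl g) (mem_univ _) trivial
      tauto
    · have := hrim s
      tauto
  intro Y Z hs
  by_cases hhub : ∃ h, Sum.inl h ∉ Z
  · obtain ⟨h, hh⟩ := hhub
    by_cases hY : Sum.inl h ∈ Y
    · exact key Y Z h hs hY
    · exact key _ Z h hs.compl (by simp [hY, hh])
  · push Not at hhub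
    have hsub : hubs k ⊆ Z := by
      intro x hx
      obtain ⟨r, -, rfl⟩ := mem_map.1 hx
      exact hhub r
    have hrimZ : ∀ r, Sum.inr r ∉ Z := by
      intro r hr
      have h1 : insert (Sum.inr r) (hubs k) ⊆ Z := insert_subset hr hsub
      have h2 := card_le_card h1
      rw [card_insert_of_notMem (inr_not_mem_hubs r), card_hubs] at h2
      have := hs.card_lt
      omega
    have hstep : ∀ r : Fin (k + 2 + 1), Sum.inr r ∈ Y → Sum.inr (r + 1) ∈ Y := fun r hr =>
      (hs.closed _ hr (Sum.inr (r + 1)) (mem_univ _) (Or.inl rfl)).resolve_right (hrimZ _)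
    have hup : ∀ (r : Fin (k + 2 + 1)) (n : ℕ) (hn : r.val + n < k + 2 + 1), Sum.inr r ∈ Y →
        Sum.inr (⟨r.val + n, hn⟩ : Fin (k + 2 + 1)) ∈ Y := by
      intro r n
      induction n with
      | zero => exact fun _ h => h
      | succ n ih =>
        intro hn hr
        have h1 := hstep _ (ih (by omega) hr)
        convert h1 using 2
        rw [Fin.ext_iff, val_add_one_eq]
        grind
    obtain ⟨y, hy⟩ := hs.nonempty
    obtain ⟨r, rfl⟩ : ∃ r, y = Sum.inr r := by
      rcases y with g | r
      · exact absurd (hhub g) (disjoint_left.1 hs.disjoint hy)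
      · exact ⟨r, rfl⟩
    have hlast := hstep _ (hup r (k + 2 - r.val) (by omega) hy)
    obtain ⟨x, -, hxY, hxZ⟩ := hs.exists_not_mem
    rcases x with g | s
    · exact hxZ (hhub g)
    · refine hxY ?_
      have h1 := hup _ s.val (by rw [val_add_one_eq]; grind) hlast
      convert h1 using 2
      rw [Fin.ext_iff]
      simp only [val_add_one_eq]
      grind

lemma hubCycle_le_degree {k : ℕ} (hk : 1 ≤ k) (v : Fin (k - 1) ⊕ Fin (k + 2 + 1)) :
    k + 1 ≤ (hubCycle k).degree v := by
  rw [← SimpleGraph.card_neighborFinset_eq_degree]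
  rcases v with h | a
  · have h1 : (univ : Finset (Fin (k + 2 + 1))).map .inr ⊆
        (hubCycle k).neighborFinset (Sum.inl h) := by
      intro x hx
      obtain ⟨r, -, rfl⟩ := mem_map.1 hx
      rw [SimpleGraph.mem_neighborFinset]
      trivial
    have h2 := card_le_card h1
    rw [card_map, card_univ, Fintype.card_fin] at h2
    omega
  · have h1 : insert (Sum.inr (a + 1)) (insert (Sum.inr (a - 1)) (hubs k)) ⊆
        (hubCycle k).neighborFinset (Sum.inr a) := by
      intro x hx
      rw [SimpleGraph.mem_neighborFinset]
      simp only [mem_insert] at hx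
      rcases hx with rfl | rfl | hx
      · exact Or.inl rfl
      · exact Or.inr (sub_add_cancel a 1).symm
      · obtain ⟨r, -, rfl⟩ := mem_map.1 hx
        trivial
    have hne : a + 1 ≠ a - 1 := fun h => by
      have h2 : a + 1 + 1 = a := by rw [h, sub_add_cancel]
      have h3 := congrArg Fin.val h2
      rw [val_add_one_eq, val_add_one_eq] at h3
      split_ifs at h3 <;> omega
    have h2 := card_le_card h1
    rw [card_insert_of_notMem (by
      simp only [mem_insert, Sum.inr.injEq, hne, false_or]; exact inr_not_mem_hubs _),
      card_insert_of_notMem (inr_not_mem_hubs _), card_hubs] at h2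
    omega

/-- Every `k`-removable matching of `hubCycle k` has at most `k` edges: it uses at most `k - 1`
edges at the hubs, and at most one edge of the cycle, since two of them would disconnect it. -/
lemma hubCycle_card_cov_le {k : ℕ} (hk : 1 ≤ k)
    {N : SimpleGraph (Fin (k - 1) ⊕ Fin (k + 2 + 1))} (hN : Removable (hubCycle k) N k) :
    #(cov N) ≤ 2 * k := by
  by_contra! hlt
  obtain ⟨σ, hσ⟩ := exists_partner N
  have hσ' : ∀ x y, N.Adj x y → y = σ x := fun x y hxy =>
    hN.1.unique x y (σ x) hxy (hσ x (left_mem_cov hxy))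
  have hT : #(hubs k ∪ (hubs k).image σ) ≤ 2 * k - 2 := by
    have h1 := card_union_le (hubs k) ((hubs k).image σ)
    have h2 := card_image_le (s := hubs k) (f := σ)
    rw [card_hubs] at h1 h2
    omega
  have hrim : ∀ s : Finset _, hubs k ∪ (hubs k).image σ ⊆ s → #s ≤ 2 * k →
      ∃ a b, N.Adj (Sum.inr a) (Sum.inr b) ∧ Sum.inr a ∉ s := by
    intro s hsub hs
    obtain ⟨x, hx, hxs⟩ := exists_mem_notMem_of_card_lt_card (hs.trans_lt hlt)
    obtain ⟨y, hxy⟩ := mem_cov.1 hx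
    have hyh : y ∉ hubs k := fun h => hxs (hsub (mem_union_right _
      (mem_image.2 ⟨y, h, (hσ' y x hxy.symm).symm⟩)))
    have hxh : x ∉ hubs k := fun h => hxs (hsub (mem_union_left _ h))
    rcases x with g | a
    · exact absurd (inl_mem_hubs g) hxh
    rcases y with g | b
    · exact absurd (inl_mem_hubs g) hyh
    exact ⟨a, b, hxy, hxs⟩
  obtain ⟨a, b, hab, -⟩ := hrim _ Subset.rfl (by omega)
  obtain ⟨c, d, hcd, hc⟩ := hrim (insert (Sum.inr a) (insert (Sum.inr b)
    (hubs k ∪ (hubs k).image σ))) (fun x hx => mem_insert_of_mem (mem_insert_of_mem hx)) (by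
      have h1 := card_insert_le (Sum.inr a) (insert (Sum.inr b) (hubs k ∪ (hubs k).image σ))
      have h2 := card_insert_le (Sum.inr b) (hubs k ∪ (hubs k).image σ)
      omega)
  have hca : c ≠ a := fun h => hc (by rw [h]; exact mem_insert_self _ _)
  have hcb : c ≠ b := fun h => hc (by rw [h]; exact mem_insert_of_mem (mem_insert_self _ _))
  have hda : d ≠ a := fun h => by
    rw [h] at hcd
    exact hcb (Sum.inr_injective (hN.1.unique _ _ _ hcd.symm hab))
  have hdb : d ≠ b := fun h => by
    rw [h] at hcd
    exact hca (Sum.inr_injective (hN.1.unique _ _ _ hcd.symm hab.symm))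
  have hor : ∀ a b : Fin (k + 2 + 1), N.Adj (Sum.inr a) (Sum.inr b) →
      ∃ i, N.Adj (Sum.inr i) (Sum.inr (i + 1)) ∧ (i = a ∨ i = b) := by
    intro a b hab
    rcases hN.1.le hab with h | h
    · exact ⟨a, h ▸ hab, Or.inl rfl⟩
    · exact ⟨b, h ▸ hab.symm, Or.inr rfl⟩
  obtain ⟨i, hi, hi'⟩ := hor a b hab
  obtain ⟨j, hj, hj'⟩ := hor c d hcd
  have hij : i ≠ j := by grind
  -- without these two edges, the arc between them is separated by the hubs
  have key : ∀ i j : Fin (k + 2 + 1), N.Adj (Sum.inr i) (Sum.inr (i + 1)) →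
      N.Adj (Sum.inr j) (Sum.inr (j + 1)) → i < j → False := by
    intro i j hi hj hij
    refine hN.2 ((Finset.Ioc i j).map .inr) (hubs k) ⟨subset_univ _, ⟨Sum.inr j, ?_⟩, ?_, ?_, ?_,
      ⟨Sum.inr i, mem_univ _, by simp, inr_not_mem_hubs _⟩⟩
    · exact mem_map.2 ⟨j, mem_Ioc.2 ⟨hij, le_rfl⟩, rfl⟩
    · rw [disjoint_left]
      intro x hx
      obtain ⟨r, -, rfl⟩ := mem_map.1 hx
      exact inr_not_mem_hubs r
    · rw [card_hubs]
      omega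
    · intro y hy x _ hyx
      obtain ⟨r, hr, rfl⟩ := mem_map.1 hy
      rw [mem_Ioc] at hr
      rcases x with g | s
      · exact Or.inr (inl_mem_hubs g)
      left
      refine mem_map.2 ⟨s, mem_Ioc.2 ?_, rfl⟩
      obtain ⟨hadj, hno⟩ := hyx
      have hadj : s = r + 1 ∨ r = s + 1 := hadj
      have hrj : r ≠ j ∨ s ≠ r + 1 := by
        by_contra! hcon
        rw [hcon.2, hcon.1] at hno
        exact hno hj
      have hsi : s ≠ i ∨ r ≠ s + 1 := by
        by_contra! hcon
        rw [hcon.2, hcon.1] at hno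
        exact hno hi.symm
      have h1 := val_add_one_eq r
      have h2 := val_add_one_eq s
      have h3 := j.isLt
      simp only [Fin.lt_def, Fin.le_def, Fin.ext_iff, ne_eq] at *
      split_ifs at h1 h2 <;> omega
  rcases lt_or_gt_of_ne hij with h | h
  · exact key i j hi hj h
  · exact key j i hj hi h

lemma le_of_guaranteed_succ {k ℓ : ℕ} (hk : 1 ≤ k) (h : Guaranteed k (k + 1) ℓ) : ℓ ≤ k := by
  obtain ⟨M, hM, hℓ⟩ := h _ (hubCycle k)
    (isKConnected_iff.2 ⟨by simp; omega, hubCycle_kConn⟩) (by simp; omega)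
    (by
      have : Nonempty (Fin (k - 1) ⊕ Fin (k + 2 + 1)) := ⟨Sum.inr 0⟩
      exact SimpleGraph.le_minDegree_of_forall_le_degree _ _ (hubCycle_le_degree hk))
  obtain ⟨N, hN, hc⟩ := hM.exists_removable
  have := hubCycle_card_cov_le hk hN
  omega

/-! ### The function `f` -/

lemma guaranteed_of_removable {k δ ℓ : ℕ} (hk : k < δ)
    (h : ∀ (V : Type) [Fintype V] (G : SimpleGraph V), KConn G univ k →
      (∀ v, δ ≤ #{x | G.Adj v x}) → 2 * δ ≤ Fintype.card V →
        ∃ N, Removable G N k ∧ 2 * ℓ ≤ #(cov N)) : Guaranteed k δ ℓ := by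
  intro V _ G _ hG hcard hdeg
  obtain ⟨N, hN, hℓ⟩ := h V G (isKConnected_iff.1 hG).2
    (fun v => by convert le_card_filter_adj hdeg v) hcard
  exact hN.exists_isKRemovable (by omega) hℓ

lemma isGreatest_f {k δ : ℕ} (hk : k < δ) : IsGreatest {ℓ | Guaranteed k δ ℓ} (f k δ) := by
  have hbdd : BddAbove {ℓ | Guaranteed k δ ℓ} := ⟨δ, fun ℓ hℓ => le_of_guaranteed hk hℓ⟩
  have hzero : Guaranteed k δ 0 := guaranteed_of_removable hk fun V _ G hG _ _ =>
    ⟨⊥, ⟨IsMatch.bot G, by simpa using hG⟩, by simp⟩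
  exact ⟨Nat.sSup_mem ⟨0, hzero⟩ hbdd, fun ℓ hℓ => le_csSup hbdd hℓ⟩

lemma le_f {k δ ℓ : ℕ} (hk : k < δ)
    (h : ∀ (V : Type) [Fintype V] (G : SimpleGraph V), KConn G univ k →
      (∀ v, δ ≤ #{x | G.Adj v x}) → 2 * δ ≤ Fintype.card V →
        ∃ N, Removable G N k ∧ 2 * ℓ ≤ #(cov N)) : ℓ ≤ f k δ :=
  (isGreatest_f hk).2 (guaranteed_of_removable hk h)

lemma f_le {k δ : ℕ} (hk : k < δ) : f k δ ≤ δ := le_of_guaranteed hk (isGreatest_f hk).1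

lemma f_succ_le {k : ℕ} (hk : 1 ≤ k) : f k (k + 1) ≤ k :=
  le_of_guaranteed_succ hk (isGreatest_f (Nat.lt_succ_self k)).1

lemma f_one_eq {δ : ℕ} (hδ : 3 ≤ δ) : f 1 δ = δ :=
  (f_le (by omega)).antisymm (le_f (by omega) fun _ _ _ hG hdeg hcard =>
    exists_removable_of_connected hδ hG hdeg hcard)

lemma two_le_f_succ {k : ℕ} (hk : 2 ≤ k) : 2 ≤ f k (k + 1) :=
  le_f (Nat.lt_succ_self k) fun _ _ _ hG hdeg hcard => exists_removable_two hk hG hdeg hcard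

end RemovableMatching

theorem theorem6 :
    -- the maximum defining `f k δ` exists
    (∀ k δ : ℕ, 1 ≤ k → k < δ →
      IsGreatest {ℓ : ℕ | RemovableMatching.Guaranteed k δ ℓ} (RemovableMatching.f k δ)) ∧
    -- (i)
    (∀ k δ : ℕ, 1 ≤ k → k < δ → 3 * k - 1 ≤ δ →
      (¬ (k = 1 ∧ δ = 2) → ((δ : ℚ) + 1) / 2 ≤ (RemovableMatching.f k δ : ℚ)) ∧
        RemovableMatching.f k δ ≤ δ) ∧
    -- (ii)
    (RemovableMatching.f 1 2 = 1 ∧ ∀ δ : ℕ, 3 ≤ δ → RemovableMatching.f 1 δ = δ) ∧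
    -- (iii)
    (∀ δ : ℕ, 2 < δ →
      2 * ⌊((δ : ℚ) - 2) / 2⌋ ≤ (RemovableMatching.f 2 δ : ℤ) ∧ RemovableMatching.f 2 δ ≤ δ) ∧
    -- (iv)
    ((∀ k : ℕ, 2 ≤ k → 2 ≤ RemovableMatching.f k (k + 1) ∧ RemovableMatching.f k (k + 1) ≤ k) ∧
      RemovableMatching.f 2 3 = 2) := by
  refine ⟨fun k δ _ hk => RemovableMatching.isGreatest_f hk, fun k δ hk hkδ hδ => ⟨fun hne => ?_,
    RemovableMatching.f_le hkδ⟩, ⟨?_, fun δ hδ => RemovableMatching.f_one_eq hδ⟩,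
    fun δ hδ => ⟨?_, RemovableMatching.f_le hδ⟩,
    fun k hk => ⟨RemovableMatching.two_le_f_succ hk, RemovableMatching.f_succ_le (by omega)⟩,
    (RemovableMatching.f_succ_le one_le_two).antisymm (RemovableMatching.two_le_f_succ le_rfl)⟩
  · have h : δ + 1 ≤ 2 * RemovableMatching.f k δ := by
      rcases Nat.lt_or_ge k 2 with hk2 | hk2
      · obtain rfl : k = 1 := by omega
        rw [RemovableMatching.f_one_eq (by omega)]
        omega
      · have := RemovableMatching.le_f hkδ fun _ _ _ hG hdeg hcard =>
          RemovableMatching.exists_removable_of_three_mul_le hk2 hδ hG hdeg hcard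
        omega
    have h' : (δ : ℚ) + 1 ≤ 2 * (RemovableMatching.f k δ : ℚ) := by exact_mod_cast h
    linarith
  · exact (RemovableMatching.f_succ_le le_rfl).antisymm
      (RemovableMatching.le_f one_lt_two fun _ _ _ hG hdeg hcard =>
        RemovableMatching.exists_removable_one hG hdeg hcard)
  · have h : δ ≤ RemovableMatching.f 2 δ + 2 ∨ δ = 3 := by
      rcases Nat.lt_or_ge δ 4 with h4 | h4
      · omega
      · have := RemovableMatching.le_f hδ fun _ _ _ hG hdeg hcard =>
          RemovableMatching.exists_removable_of_two_connected h4 hG hdeg hcard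
        omega
    rcases h with h | rfl
    · have h1 : (2 * ⌊((δ : ℚ) - 2) / 2⌋ : ℚ) ≤ δ - 2 := by
        have := Int.floor_le (((δ : ℚ) - 2) / 2)
        linarith
      have h2 : (2 * ⌊((δ : ℚ) - 2) / 2⌋ : ℤ) ≤ (δ : ℤ) - 2 := by exact_mod_cast h1
      omega
    · have h1 : ⌊(((3 : ℕ) : ℚ) - 2) / 2⌋ = 0 := by norm_num
      rw [h1]
      positivity
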